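/- Let $k$ be a field, let $n\ge 1$, and let $\mathbf q=(q_{ij})$ be an $n\times n$ matrix over $k$ with $q_{ii}=1$ and $q_{ij}q_{ji}=1$ for all $1\le i,j\le n$. Let $$A=\mathcal O_{\mathbf q}(k^n)=k\langle x_1,\dots,x_n\rangle/(x_jx_i-q_{ij}x_ix_j,\ 1\le i,j\le n)$$ be the multiparameter quantum affine $n$-space. Write $A^e=A\otimes_k A^{\mathrm{op}}$, and identify left $A^e$-modules with $A$-$A$-bimodules. For a $k$-algebra automorphism $\nu$ of $A$, let $A^\nu$ be the bimodule with underlying space $A$ and action $a\cdot m\cdot b=am\,\nu(b)$. Call $A$ *$\nu$-twisted Calabi–Yau of dimension $d$*, with *Nakayama automorphism* $\nu$, if 1. $A$ is homologically smooth, i.e. $A$ has a resolution of finite length by finitely generated projective $A^e$-modules; and 2. $\mathrm{Ext}^i_{A^e}(A,A^e)=0$ for $i\ne d$, and $\mathrm{Ext}^d_{A^e}(A,A^e)\cong A^\nu$ as bimodules. Here $\mathrm{Ext}$ is computed with the outer (left regular) structure $a\cdot(u\otimes v)\cdot b=au\otimes vb$ on $A^e$, and carries the bimodule structure induced by the inner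 structure $a\cdot(u\otimes v)\cdot b=ub\otimes av$. Then $A$ is twisted Calabi–Yau of dimension $n$: there is exactly one $k$-algebra automorphism $\nu$ of $A$ for which $A$ is $\nu$-twisted Calabi–Yau of dimension $n$, and this Nakayama automorphism is given by $$\nu(x_i)=\Bigl(\prod_{j=1}^n q_{ji}\Bigr)x_i,\qquad 1\le i\le n.$$ -/

import Mathlib

open scoped TensorProduct

universe v u

section TwistedCalabiYau

open MulOpposite CategoryTheory

variable (k : Type v) [CommRing k] (A : Type u) [Ring A] [Algebra k A]

/-- The enveloping algebra `A ⊗ Aᵒᵖ`. Left modules over it are the `A`-`A`-bimodules on which `k`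
acts centrally: `(a ⊗ bᵒᵖ) • m` is `a · m · b`. -/
abbrev EnvelopingAlgebra : Type u := A ⊗[k] Aᵐᵒᵖ

variable {A}

/-- The bimodule `A^ν`: its underlying `k`-module is `A`, and `a · m · b = a m ν(b)`. -/
def TwistedBimodule (_ν : A ≃ₐ[k] A) : Type u := A

namespace TwistedBimodule

variable {k} (ν : A ≃ₐ[k] A)

instance : AddCommGroup (TwistedBimodule k ν) := inferInstanceAs (AddCommGroup A)

/-- The identity map `A → A^ν`. -/
def of : A ≃+ TwistedBimodule k ν := AddEquiv.refl A

/-- The representation of `A ⊗ Aᵒᵖ` on `A` in which `a ⊗ bᵒᵖ` acts by `m ↦ a m ν(b)`. -/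
noncomputable def action : EnvelopingAlgebra k A →ₐ[k] Module.End k A :=
  Algebra.TensorProduct.lift
    (Algebra.lmul k A)
    ((Algebra.lsmul k k A : Aᵐᵒᵖ →ₐ[k] Module.End k A).comp (AlgEquiv.op ν).toAlgHom)
    (fun a b => LinearMap.ext fun m => (mul_assoc a m (ν b.unop)).symm)

theorem action_tmul (a b m : A) : action ν (a ⊗ₜ op b) m = a * m * ν b :=
  (congrArg (fun f : Module.End k A => f m)
    (Algebra.TensorProduct.lift_tmul _ _ _ a (op b))).trans (mul_assoc a m (ν b)).symm

noncomputable instance : Module (EnvelopingAlgebra k A) (TwistedBimodule k ν) :=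
  Module.compHom A (action ν).toRingHom

theorem tmul_op_smul (a b m : A) :
    (a ⊗ₜ[k] op b : EnvelopingAlgebra k A) • of ν m = of ν (a * m * ν b) :=
  action_tmul ν a b m

end TwistedBimodule

variable (A)

/-- `A` itself as an `A`-`A`-bimodule, with `a · m · b = a m b`. -/
abbrev RegularBimodule : Type u := TwistedBimodule k (AlgEquiv.refl : A ≃ₐ[k] A)

/-- `A` is homologically smooth: as an `A ⊗ Aᵒᵖ`-module it has a resolution of finite length by
finitely generated projective modules. -/
def IsHomologicallySmooth : Prop :=
  ∃ P : ProjectiveResolution (ModuleCat.of (EnvelopingAlgebra k A) (RegularBimodule k A)),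
    (∀ i, Module.Finite (EnvelopingAlgebra k A) (P.complex.X i)) ∧
      ∃ N : ℕ, ∀ i, N < i → Limits.IsZero (P.complex.X i)

namespace EnvelopingAlgebra

/-- The flip `a ⊗ bᵒᵖ ↦ b ⊗ aᵒᵖ`, as an algebra isomorphism from `A ⊗ Aᵒᵖ` to its opposite. -/
noncomputable def flipOp : EnvelopingAlgebra k A ≃ₐ[k] (EnvelopingAlgebra k A)ᵐᵒᵖ :=
  ((Algebra.TensorProduct.congr (AlgEquiv.opOp k A) AlgEquiv.refl).trans
    (Algebra.TensorProduct.opAlgEquiv k k Aᵐᵒᵖ A)).trans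
      (AlgEquiv.op (Algebra.TensorProduct.comm k Aᵐᵒᵖ A))

variable {A}

theorem flipOp_tmul (a b : A) :
    flipOp k A (a ⊗ₜ op b) = op (b ⊗ₜ op a) := rfl

variable {k}

/-- The inner action of `A ⊗ Aᵒᵖ` on itself, by endomorphisms of the outer (left regular)
module: `a ⊗ bᵒᵖ` sends `m ⊗ n` to `m b ⊗ a n`, the second product being that of `A`. -/
noncomputable def innerAction (r : EnvelopingAlgebra k A) :
    ModuleCat.of (EnvelopingAlgebra k A) (EnvelopingAlgebra k A) ⟶
      ModuleCat.of (EnvelopingAlgebra k A) (EnvelopingAlgebra k A) :=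
  ModuleCat.ofHom
    (LinearMap.toSpanSingleton (EnvelopingAlgebra k A) (EnvelopingAlgebra k A)
      (flipOp k A r).unop)

theorem innerAction_apply (r s : EnvelopingAlgebra k A) :
    (innerAction r).hom s = s * (flipOp k A r).unop := rfl

theorem innerAction_tmul (a b m n : A) :
    (innerAction (a ⊗ₜ[k] op b)).hom (m ⊗ₜ[k] op n) = (m * b) ⊗ₜ[k] op (a * n) := by
  rw [innerAction_apply, flipOp_tmul, unop_op, Algebra.TensorProduct.tmul_mul_tmul, ← op_mul]

theorem innerAction_one : innerAction (1 : EnvelopingAlgebra k A) = 𝟙 _ :=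
  ModuleCat.hom_ext <| LinearMap.ext fun (s : EnvelopingAlgebra k A) =>
    show s * (flipOp k A 1).unop = s by rw [map_one, unop_one, mul_one]

theorem innerAction_zero : innerAction (0 : EnvelopingAlgebra k A) = 0 :=
  ModuleCat.hom_ext <| LinearMap.ext fun (s : EnvelopingAlgebra k A) =>
    show s * (flipOp k A 0).unop = 0 by rw [map_zero, unop_zero, mul_zero]

theorem innerAction_add (r s : EnvelopingAlgebra k A) :
    innerAction (r + s) = innerAction r + innerAction s :=
  ModuleCat.hom_ext <| LinearMap.ext fun (t : EnvelopingAlgebra k A) =>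
    show t * (flipOp k A (r + s)).unop = t * (flipOp k A r).unop + t * (flipOp k A s).unop by
      rw [map_add, MulOpposite.unop_add, mul_add]

theorem innerAction_mul (r s : EnvelopingAlgebra k A) :
    innerAction (r * s) = innerAction s ≫ innerAction r :=
  ModuleCat.hom_ext <| LinearMap.ext fun (t : EnvelopingAlgebra k A) =>
    show t * (flipOp k A (r * s)).unop = t * (flipOp k A s).unop * (flipOp k A r).unop by
      rw [map_mul, unop_mul, mul_assoc]

end EnvelopingAlgebra

/-- The group `Ext^i(A, A ⊗ Aᵒᵖ)` over `A ⊗ Aᵒᵖ`, computed with the outer structure on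
`A ⊗ Aᵒᵖ`. -/
def BimoduleExt (i : ℕ) : Type u :=
  Abelian.Ext.{u} (ModuleCat.of (EnvelopingAlgebra k A) (RegularBimodule k A))
    (ModuleCat.of (EnvelopingAlgebra k A) (EnvelopingAlgebra k A)) i

namespace BimoduleExt

open EnvelopingAlgebra

noncomputable instance (i : ℕ) : AddCommGroup (BimoduleExt k A i) :=
  inferInstanceAs (AddCommGroup (Abelian.Ext.{u}
    (ModuleCat.of (EnvelopingAlgebra k A) (RegularBimodule k A))
    (ModuleCat.of (EnvelopingAlgebra k A) (EnvelopingAlgebra k A)) i))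

variable {k A}

/-- The action of `r` on `Ext^i(A, A ⊗ Aᵒᵖ)` is induced by its inner action on the second
argument. -/
noncomputable instance (i : ℕ) : SMul (EnvelopingAlgebra k A) (BimoduleExt k A i) where
  smul r α := Abelian.Ext.comp α (Abelian.Ext.mk₀ (innerAction r)) (add_zero i)

theorem smul_def {i : ℕ} (r : EnvelopingAlgebra k A)
    (α : Abelian.Ext.{u} (ModuleCat.of (EnvelopingAlgebra k A) (RegularBimodule k A))
      (ModuleCat.of (EnvelopingAlgebra k A) (EnvelopingAlgebra k A)) i) :
    (r • (show BimoduleExt k A i from α) : BimoduleExt k A i) =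
      α.comp (Abelian.Ext.mk₀ (innerAction r)) (add_zero i) := rfl

noncomputable instance (i : ℕ) : Module (EnvelopingAlgebra k A) (BimoduleExt k A i) where
  one_smul α := (congrArg (fun f => Abelian.Ext.comp α (Abelian.Ext.mk₀ f) (add_zero i))
    innerAction_one).trans (Abelian.Ext.comp_mk₀_id α)
  mul_smul r s α := (congrArg (fun f => Abelian.Ext.comp α (Abelian.Ext.mk₀ f) (add_zero i))
    (innerAction_mul r s)).trans <|
      (congrArg (fun f => Abelian.Ext.comp α f (add_zero i))
        (Abelian.Ext.mk₀_comp_mk₀ (innerAction s) (innerAction r)).symm).trans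
      (Abelian.Ext.comp_assoc_of_third_deg_zero α _ _ (add_zero i)).symm
  smul_zero r := Abelian.Ext.zero_comp _ _ (Abelian.Ext.mk₀ (innerAction r)) i (add_zero i)
  smul_add r α β := Abelian.Ext.add_comp α β (Abelian.Ext.mk₀ (innerAction r)) (add_zero i)
  add_smul r s α := (congrArg (fun f => Abelian.Ext.comp α f (add_zero i))
    ((congrArg Abelian.Ext.mk₀ (innerAction_add r s)).trans (Abelian.Ext.mk₀_add _ _))).trans
      (Abelian.Ext.comp_add α _ _ (add_zero i))
  zero_smul α := (congrArg (fun f => Abelian.Ext.comp α f (add_zero i))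
    ((congrArg Abelian.Ext.mk₀ innerAction_zero).trans (Abelian.Ext.mk₀_zero _ _))).trans
      (Abelian.Ext.comp_zero α _ 0 i (add_zero i))

end BimoduleExt

variable {A}

/-- `A` is `ν`-twisted Calabi–Yau of dimension `d`, i.e. twisted Calabi–Yau of dimension `d` with
Nakayama automorphism `ν`. -/
structure IsTwistedCalabiYau (ν : A ≃ₐ[k] A) (d : ℕ) : Prop where
  smooth : IsHomologicallySmooth k A
  ext_eq_zero : ∀ i : ℕ, i ≠ d → Subsingleton (BimoduleExt k A i)
  ext_iso : Nonempty (BimoduleExt k A d ≃ₗ[EnvelopingAlgebra k A] TwistedBimodule k ν)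

end TwistedCalabiYau

section QuantumAffineSpace

variable {k : Type v} [CommRing k] {n : ℕ}

/-- The relations `x_j x_i = q_{ij} x_i x_j` on the free algebra on `x_1, …, x_n`. -/
inductive QuantumAffineSpace.Rel (q : Matrix (Fin n) (Fin n) k) :
    FreeAlgebra k (Fin n) → FreeAlgebra k (Fin n) → Prop
  | comm (i j : Fin n) : Rel q
      (FreeAlgebra.ι k j * FreeAlgebra.ι k i)
      (q i j • (FreeAlgebra.ι k i * FreeAlgebra.ι k j))

/-- The multiparameter quantum affine `n`-space
`k⟨x_1, …, x_n⟩ / (x_j x_i - q_{ij} x_i x_j)`. -/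
abbrev QuantumAffineSpace (q : Matrix (Fin n) (Fin n) k) : Type v :=
  RingQuot (QuantumAffineSpace.Rel q)

/-- The generator `x_i`. -/
noncomputable def QuantumAffineSpace.x (q : Matrix (Fin n) (Fin n) k) (i : Fin n) :
    QuantumAffineSpace q :=
  RingQuot.mkAlgHom k (QuantumAffineSpace.Rel q) (FreeAlgebra.ι k i)

end QuantumAffineSpace

/-!
Let `R = A ⊗ Aᵒᵖ` and, for units `κ_1, …, κ_n` of `k`, consider the linear forms
`x_i ⊗ 1 - κ_i (1 ⊗ x_i)` of `R`. If `ν⁻¹(x_i) = κ_i x_i`, then `A^ν` is the quotient of `R` by the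
left ideal generated by all of them. Two linear forms commute up to a change of the parameters `κ`,
and right multiplication by `x_j ⊗ 1 - κ_j (1 ⊗ x_j)` is injective from `R / (κ', S)` to
`R / (κ, S)`, where `j ∉ S`, `κ'_i = q_{ji} κ_i` and `(κ, S)` is the left ideal generated by the
forms with `i ∈ S`. Adjoining the generators one at a time therefore gives short exact sequences
`0 → R / (κ', S) → R / (κ, S) → R / (κ, S ∪ {j}) → 0`, which replace the Koszul resolution. They
bound the length of a finite projective resolution, and their long exact sequences show that
`Ext^*(R / (κ, S), R)` is concentrated in degree `|S|`, where it is the quotient of `R` by the left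
ideal `(κ^∨, S)` with `κ^∨_i = κ_i⁻¹ ∏_{l ∈ S} q_{il}`. For `κ = 1` and `S = {1, …, n}` this is
`A^ν` with `ν(x_i) = (∏_l q_{li}) x_i`.

An isomorphism `A^ν ≅ A^ν'` makes `ν` and `ν'` differ by conjugation by a unit of `A`. The
multigrading shows that `A` is a domain, so its units are scalars and `ν' = ν`.
-/

namespace TwistedBimodule

open MulOpposite

section Presentation

variable {k : Type v} [CommRing k] {A : Type u} [Ring A] [Algebra k A]

/-- The left ideal of `A ⊗ Aᵒᵖ` generated by the elements `g ⊗ 1 - 1 ⊗ ν⁻¹(g)` with `g ∈ G`. When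
`G` generates `A`, it is the annihilator of the generator `1` of `A^ν`. -/
noncomputable def relatorIdeal (ν : A ≃ₐ[k] A) (G : Set A) :
    Submodule (EnvelopingAlgebra k A) (EnvelopingAlgebra k A) :=
  Submodule.span _ ((fun g => g ⊗ₜ 1 - 1 ⊗ₜ op (ν.symm g)) '' G)

variable (ν : A ≃ₐ[k] A)

/-- The bimodule map `A ⊗ Aᵒᵖ → A^ν` sending `1` to `1`. -/
noncomputable def evalOne : EnvelopingAlgebra k A →ₗ[EnvelopingAlgebra k A] TwistedBimodule k ν :=
  LinearMap.toSpanSingleton _ _ (of ν 1)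

theorem evalOne_tmul (a b : A) : evalOne ν (a ⊗ₜ op b) = of ν (a * ν b) := by
  rw [evalOne, LinearMap.toSpanSingleton_apply, tmul_op_smul, mul_one]

theorem evalOne_tmul_one (a : A) : evalOne ν (a ⊗ₜ 1) = of ν a := by
  rw [← op_one, evalOne_tmul, map_one, mul_one]

theorem evalOne_surjective : Function.Surjective (evalOne ν) :=
  fun m => ⟨(of ν).symm m ⊗ₜ 1, evalOne_tmul_one ν _⟩

theorem relatorIdeal_le_ker_evalOne (G : Set A) :
    relatorIdeal ν G ≤ LinearMap.ker (evalOne ν) := by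
  rw [relatorIdeal, Submodule.span_le]
  rintro _ ⟨g, -, rfl⟩
  rw [SetLike.mem_coe, LinearMap.mem_ker, map_sub, evalOne_tmul_one, evalOne_tmul, one_mul,
    AlgEquiv.apply_symm_apply, sub_self]

variable {G : Set A} (hG : Algebra.adjoin k G = ⊤)
include hG

theorem tmul_one_sub_mem_relatorIdeal (a : A) :
    a ⊗ₜ 1 - 1 ⊗ₜ op (ν.symm a) ∈ relatorIdeal ν G := by
  induction (hG ▸ Algebra.mem_top : a ∈ Algebra.adjoin k G) using Algebra.adjoin_induction with
  | mem g hg => exact Submodule.subset_span ⟨g, hg, rfl⟩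
  | algebraMap c =>
    simp [Algebra.algebraMap_eq_smul_one, ← TensorProduct.smul_tmul', TensorProduct.tmul_smul]
  | add a b _ _ ha hb =>
    simpa only [TensorProduct.add_tmul, map_add, op_add, TensorProduct.tmul_add, add_sub_add_comm]
      using add_mem ha hb
  | mul a b _ _ ha hb =>
    have split : (a * b) ⊗ₜ[k] 1 - 1 ⊗ₜ op (ν.symm (a * b)) =
        (a ⊗ₜ 1) * (b ⊗ₜ 1 - 1 ⊗ₜ op (ν.symm b)) +
          (1 ⊗ₜ op (ν.symm b)) * (a ⊗ₜ 1 - 1 ⊗ₜ op (ν.symm a)) := by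
      simp [mul_sub]
    rw [split]
    exact add_mem (Submodule.smul_mem _ _ hb) (Submodule.smul_mem _ _ ha)

theorem exists_sub_tmul_one_mem_relatorIdeal (r : EnvelopingAlgebra k A) :
    ∃ a : A, r - a ⊗ₜ 1 ∈ relatorIdeal ν G := by
  induction r using TensorProduct.induction_on with
  | zero => exact ⟨0, by simp⟩
  | tmul a b =>
    refine ⟨a * ν b.unop, ?_⟩
    have h := Submodule.smul_mem _ (a ⊗ₜ 1)
      (neg_mem (tmul_one_sub_mem_relatorIdeal ν hG (ν b.unop)))
    simpa [mul_sub] using h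
  | add r s hr hs =>
    obtain ⟨a, ha⟩ := hr
    obtain ⟨b, hb⟩ := hs
    exact ⟨a + b, by simpa only [TensorProduct.add_tmul, add_sub_add_comm] using add_mem ha hb⟩

theorem ker_evalOne : LinearMap.ker (evalOne ν) = relatorIdeal ν G := by
  refine le_antisymm (fun r hr => ?_) (relatorIdeal_le_ker_evalOne ν G)
  obtain ⟨a, ha⟩ := exists_sub_tmul_one_mem_relatorIdeal ν hG r
  have ha_zero : of ν a = 0 := by
    have h := relatorIdeal_le_ker_evalOne ν G ha
    rwa [LinearMap.mem_ker, map_sub, LinearMap.mem_ker.mp hr, evalOne_tmul_one, zero_sub,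
      neg_eq_zero] at h
  rw [(map_eq_zero_iff _ (of ν).injective).mp ha_zero] at ha
  simpa using ha

/-- The presentation of `A^ν` as a cyclic bimodule. -/
noncomputable def quotRelatorIdealEquiv :
    (EnvelopingAlgebra k A ⧸ relatorIdeal ν G) ≃ₗ[EnvelopingAlgebra k A] TwistedBimodule k ν :=
  (Submodule.quotEquivOfEq _ _ (ker_evalOne ν hG).symm).trans
    ((evalOne ν).quotKerEquivOfSurjective (evalOne_surjective ν))

end Presentation

section Isomorphism

variable {k : Type v} [CommRing k] {A : Type u} [Ring A] [Algebra k A] {ν ν' : A ≃ₐ[k] A}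

theorem map_of_mul (f : TwistedBimodule k ν →ₗ[EnvelopingAlgebra k A] TwistedBimodule k ν')
    (a b : A) : f (of ν (a * ν b)) = of ν' (a * (of ν').symm (f (of ν 1)) * ν' b) := by
  rw [← tmul_op_smul, AddEquiv.apply_symm_apply, ← map_smul, tmul_op_smul, mul_one]

theorem map_of (f : TwistedBimodule k ν →ₗ[EnvelopingAlgebra k A] TwistedBimodule k ν') (a : A) :
    f (of ν a) = of ν' (a * (of ν').symm (f (of ν 1))) := by
  simpa only [map_one, mul_one] using map_of_mul f a 1

theorem exists_unit_of_linearEquiv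
    (e : TwistedBimodule k ν ≃ₗ[EnvelopingAlgebra k A] TwistedBimodule k ν') :
    ∃ u : Aˣ, ∀ a, ν a * u = u * ν' a := by
  set u := (of ν').symm (e (of ν 1)) with hu
  set v := (of ν).symm (e.symm (of ν' 1)) with hv
  have e_of (a : A) : e (of ν a) = of ν' (a * u) := map_of e.toLinearMap a
  have e_symm_of (a : A) : e.symm (of ν' a) = of ν (a * v) := map_of e.symm.toLinearMap a
  have u_mul_v : u * v = 1 := (of ν).injective <| by
    rw [← e_symm_of, hu, AddEquiv.apply_symm_apply, LinearEquiv.symm_apply_apply]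
  have v_mul_u : v * u = 1 := (of ν').injective <| by
    rw [← e_of, hv, AddEquiv.apply_symm_apply, LinearEquiv.apply_symm_apply]
  refine ⟨⟨u, v, u_mul_v, v_mul_u⟩, fun a => (of ν').injective ?_⟩
  calc of ν' (ν a * u) = e (of ν (1 * ν a)) := by rw [one_mul, e_of]
    _ = of ν' (1 * u * ν' a) := map_of_mul e.toLinearMap 1 a
    _ = of ν' (u * ν' a) := by rw [one_mul]

theorem eq_of_linearEquiv (units_central : ∀ (u : Aˣ) (a : A), Commute (u : A) a)
    (e : TwistedBimodule k ν ≃ₗ[EnvelopingAlgebra k A] TwistedBimodule k ν') : ν = ν' := by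
  obtain ⟨u, hu⟩ := exists_unit_of_linearEquiv e
  exact AlgEquiv.ext fun a => u.isUnit.mul_right_cancel ((hu a).trans (units_central u (ν' a)))

end Isomorphism

end TwistedBimodule

section FiniteProjectiveResolutions

open CategoryTheory

theorem exists_exact_ker_of_ladder {R A₁ B₁ C₁ A₂ B₂ C₂ : Type*} [Ring R]
    [AddCommGroup A₁] [Module R A₁] [AddCommGroup B₁] [Module R B₁] [AddCommGroup C₁] [Module R C₁]
    [AddCommGroup A₂] [Module R A₂] [AddCommGroup B₂] [Module R B₂] [AddCommGroup C₂] [Module R C₂]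
    {i₁ : A₁ →ₗ[R] B₁} {p₁ : B₁ →ₗ[R] C₁} {i₂ : A₂ →ₗ[R] B₂} {p₂ : B₂ →ₗ[R] C₂}
    {f : A₁ →ₗ[R] A₂} {h : B₁ →ₗ[R] B₂} {g : C₁ →ₗ[R] C₂}
    (hi₁ : Function.Injective i₁) (hp₁ : Function.Surjective p₁) (h₁ : Function.Exact i₁ p₁)
    (hi₂ : Function.Injective i₂) (h₂ : Function.Exact i₂ p₂) (hf : Function.Surjective f)
    (comm_i : ∀ a, h (i₁ a) = i₂ (f a)) (comm_p : ∀ b, g (p₁ b) = p₂ (h b)) :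
    ∃ (i : LinearMap.ker f →ₗ[R] LinearMap.ker h) (p : LinearMap.ker h →ₗ[R] LinearMap.ker g),
      Function.Injective i ∧ Function.Surjective p ∧ Function.Exact i p := by
  refine ⟨i₁.restrict fun a ha => ?_, p₁.restrict fun b hb => ?_, fun x y hxy => ?_, ?_, ?_⟩
  · rw [LinearMap.mem_ker] at ha ⊢
    rw [comm_i, ha, map_zero]
  · rw [LinearMap.mem_ker] at hb ⊢
    rw [comm_p, hb, map_zero]
  · exact Subtype.ext (hi₁ (congrArg Subtype.val hxy))
  · rintro ⟨c, hc⟩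
    obtain ⟨b, rfl⟩ := hp₁ c
    obtain ⟨a₂, ha₂⟩ := (h₂ (h b)).1 (by rwa [← comm_p])
    obtain ⟨a, rfl⟩ := hf a₂
    refine ⟨⟨b - i₁ a, ?_⟩, Subtype.ext ?_⟩
    · rw [LinearMap.mem_ker, map_sub, comm_i, ha₂, sub_self]
    · change p₁ (b - i₁ a) = p₁ b
      rw [map_sub, h₁.apply_apply_eq_zero, sub_zero]
  · rintro ⟨b, hb⟩
    constructor
    · intro hpb
      obtain ⟨a, rfl⟩ := (h₁ b).1 (congrArg Subtype.val hpb)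
      rw [LinearMap.mem_ker, comm_i, map_eq_zero_iff _ hi₂] at hb
      exact ⟨⟨a, hb⟩, rfl⟩
    · rintro ⟨a, ha⟩
      rw [← ha]
      exact Subtype.ext (h₁.apply_apply_eq_zero a.1)

/-- `M` has a resolution by finitely generated projective modules which vanish in degrees `≥ d`. -/
def HasFiniteProjectiveResolution (R : Type u) [Ring R] :
    ℕ → ∀ (M : Type u) [AddCommGroup M] [Module R M], Prop
  | 0, M, _, _ => Subsingleton M
  | d + 1, M, _, _ => ∃ (P : Type u) (_ : AddCommGroup P) (_ : Module R P) (f : P →ₗ[R] M),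
      Module.Projective R P ∧ Module.Finite R P ∧ Function.Surjective f ∧
        HasFiniteProjectiveResolution R d (LinearMap.ker f)

namespace HasFiniteProjectiveResolution

variable {R : Type u} [Ring R]

theorem of_equiv {d : ℕ} {M N : Type u} [AddCommGroup M] [Module R M] [AddCommGroup N]
    [Module R N] (e : M ≃ₗ[R] N) (h : HasFiniteProjectiveResolution R d M) :
    HasFiniteProjectiveResolution R d N := by
  cases d with
  | zero =>
    have : Subsingleton M := h
    exact e.symm.injective.subsingleton
  | succ d =>
    obtain ⟨P, _, _, f, hP, hfin, hf, hker⟩ := h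
    refine ⟨P, _, _, e.toLinearMap ∘ₗ f, hP, hfin, e.surjective.comp hf, ?_⟩
    rwa [LinearEquiv.ker_comp]

theorem of_projective (M : Type u) [AddCommGroup M] [Module R M] [Module.Projective R M]
    [Module.Finite R M] : HasFiniteProjectiveResolution R 1 M :=
  ⟨M, _, _, LinearMap.id, inferInstance, inferInstance, Function.surjective_id,
    (LinearMap.ker_id (R := R) (M := M)).symm ▸ inferInstanceAs (Subsingleton (⊥ : Submodule R M))⟩

theorem succ {d : ℕ} {M : Type u} [AddCommGroup M] [Module R M]
    (h : HasFiniteProjectiveResolution R d M) : HasFiniteProjectiveResolution R (d + 1) M := by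
  induction d generalizing M with
  | zero =>
    have : Subsingleton M := h
    exact of_projective M
  | succ d ih =>
    obtain ⟨P, _, _, f, hP, hfin, hf, hker⟩ := h
    exact ⟨P, _, _, f, hP, hfin, hf, ih hker⟩

variable {A B C : Type u} [AddCommGroup A] [Module R A] [AddCommGroup B] [Module R B]
  [AddCommGroup C] [Module R C] {i : A →ₗ[R] B} {p : B →ₗ[R] C}

theorem of_extension {d : ℕ} (hi : Function.Injective i) (hp : Function.Surjective p)
    (hip : Function.Exact i p) (hA : HasFiniteProjectiveResolution R d A)
    (hC : HasFiniteProjectiveResolution R d C) : HasFiniteProjectiveResolution R d B := by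
  induction d generalizing A B C with
  | zero =>
    have : Subsingleton A := hA
    have : Subsingleton C := hC
    refine ⟨fun x y => ?_⟩
    obtain ⟨a, ha⟩ := (hip (x - y)).1 (Subsingleton.elim _ _)
    rw [← sub_eq_zero, ← ha, Subsingleton.elim a 0, map_zero]
  | succ d ih =>
    obtain ⟨P, _, _, f, _, _, hf, hfker⟩ := hA
    obtain ⟨Q, _, _, g, _, _, hg, hgker⟩ := hC
    obtain ⟨l, hl⟩ := Module.projective_lifting_property p g hp
    have p_l (y : Q) : p (l y) = g y := LinearMap.congr_fun hl y
    let h : P × Q →ₗ[R] B := (i ∘ₗ f).coprod l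
    have h_surjective : Function.Surjective h := by
      intro b
      obtain ⟨y, hy⟩ := hg (p b)
      obtain ⟨a, ha⟩ := (hip (b - l y)).1 (by rw [map_sub, p_l, hy, sub_self])
      obtain ⟨x, rfl⟩ := hf a
      exact ⟨(x, y), by simp [h, ha]⟩
    obtain ⟨i', p', hi', hp', hip'⟩ := exists_exact_ker_of_ladder (i₁ := LinearMap.inl R P Q)
      (p₁ := LinearMap.snd R P Q) (h := h) (g := g) LinearMap.inl_injective LinearMap.snd_surjective
      Function.Exact.inl_snd hi hip hf (fun x => by simp [h])
      (fun z => by simp [h, hip.apply_apply_eq_zero, p_l])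
    exact ⟨P × Q, _, _, h, inferInstance, inferInstance, h_surjective, ih hi' hp' hip' hfker hgker⟩

theorem of_cokernel {d : ℕ} (hi : Function.Injective i) (hp : Function.Surjective p)
    (hip : Function.Exact i p) (hA : HasFiniteProjectiveResolution R d A)
    (hB : HasFiniteProjectiveResolution R (d + 1) B) :
    HasFiniteProjectiveResolution R (d + 1) C := by
  obtain ⟨P, _, _, f, hP, hPf, hf, hfker⟩ := hB
  refine ⟨P, _, _, p ∘ₗ f, hP, hPf, hp.comp hf, ?_⟩
  let e : A ≃ₗ[R] LinearMap.ker p := (LinearEquiv.ofInjective i hi).trans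
    (LinearEquiv.ofEq _ _ (LinearMap.exact_iff.1 hip).symm)
  refine of_extension (i := Submodule.inclusion (LinearMap.ker_le_ker_comp f p))
    (p := f.restrict fun _ hx => hx) (Submodule.inclusion_injective _) ?_ ?_ hfker (hA.of_equiv e)
  · rintro ⟨b, hb⟩
    obtain ⟨x, rfl⟩ := hf b
    exact ⟨⟨x, hb⟩, rfl⟩
  · rintro ⟨x, hx⟩
    constructor
    · exact fun hfx => ⟨⟨x, congrArg Subtype.val hfx⟩, rfl⟩
    · rintro ⟨y, hy⟩
      rw [← hy]
      exact Subtype.ext y.2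

end HasFiniteProjectiveResolution

section Splicing

variable {C : Type*} [Category C] [Abelian C]

/-- A projective resolution of `Z` from an exact augmented complex `⋯ → K₁ → K₀ → Z → 0` of
projective objects. -/
noncomputable def projectiveResolutionOfExact (K : ChainComplex C ℕ)
    (projective : ∀ i, Projective (K.X i)) {Z : C} (ε : K.X 0 ⟶ Z) (w : K.d 1 0 ≫ ε = 0)
    (epi : Epi ε) (exact₀ : (ShortComplex.mk _ _ w).Exact)
    (exact_succ : ∀ i, K.ExactAt (i + 1)) : ProjectiveResolution Z where
  complex := K
  projective := projective
  π := (ChainComplex.toSingle₀Equiv _ _).symm ⟨ε, w⟩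
  quasiIso := ⟨fun i => by
    cases i
    · rw [ChainComplex.quasiIsoAt₀_iff, ShortComplex.quasiIso_iff_of_zeros']
      · refine (ShortComplex.exact_and_epi_g_iff_of_iso ?_).2 ⟨exact₀, epi⟩
        exact ShortComplex.isoMk (Iso.refl _) (Iso.refl _) (Iso.refl _)
          ((Category.id_comp _).trans (Category.comp_id _).symm)
          ((Category.id_comp _).trans ((Category.comp_id _).trans
            (ChainComplex.toSingle₀Equiv_symm_apply_f_zero ε w)).symm)
      all_goals first | rfl | exact HomologicalComplex.shape _ _ _ (by simp)
    · rw [quasiIsoAt_iff_exactAt']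
      · exact exact_succ _
      · apply ChainComplex.exactAt_succ_single_obj⟩

/-- Splicing a projective resolution of the kernel onto an epimorphism from a projective
object. -/
noncomputable def spliceProjectiveResolution {S : ShortComplex C} (hS : S.ShortExact)
    (hP : Projective S.X₂) (Q : ProjectiveResolution S.X₁) : ProjectiveResolution S.X₃ :=
  let ε : Q.complex.X 0 ⟶ S.X₁ := Q.π.f 0
  have w : Q.complex.d 1 0 ≫ ε ≫ S.f = 0 := by
    rw [← Category.assoc, show Q.complex.d 1 0 ≫ ε = 0 from Q.complex_d_comp_π_f_zero,
      Limits.zero_comp]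
  have w₀ : (ε ≫ S.f) ≫ S.g = 0 := by rw [Category.assoc, S.zero, Limits.comp_zero]
  projectiveResolutionOfExact (ChainComplex.augment Q.complex (ε ≫ S.f) w)
    (fun
      | 0 => hP
      | i + 1 => Q.projective i)
    S.g w₀ hS.epi_g
    (by
      let φ : ShortComplex.mk (ε ≫ S.f) S.g w₀ ⟶ S :=
        { τ₁ := ε, τ₂ := 𝟙 _, τ₃ := 𝟙 _ }
      have : Epi φ.τ₁ := inferInstanceAs (Epi (Q.π.f 0))
      have : IsIso φ.τ₂ := inferInstanceAs (IsIso (𝟙 _))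
      have : Mono φ.τ₃ := inferInstanceAs (Mono (𝟙 _))
      exact (ShortComplex.exact_iff_of_epi_of_isIso_of_mono φ).2 hS.exact)
    (fun i => by
      rw [HomologicalComplex.exactAt_iff' _ (i + 2) (i + 1) i (by simp) (by simp)]
      match i with
      | 0 =>
        let φ : ShortComplex.mk _ _ Q.complex_d_comp_π_f_zero ⟶ ShortComplex.mk _ _ w :=
          { τ₁ := 𝟙 _, τ₂ := 𝟙 _, τ₃ := S.f }
        have : Epi φ.τ₁ := inferInstanceAs (Epi (𝟙 _))
        have : IsIso φ.τ₂ := inferInstanceAs (IsIso (𝟙 _))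
        have : Mono φ.τ₃ := hS.mono_f
        exact (ShortComplex.exact_iff_of_epi_of_isIso_of_mono φ).1 Q.exact₀
      | i + 1 => exact Q.exact_succ i)

end Splicing

theorem HasFiniteProjectiveResolution.exists_projectiveResolution {R : Type u} [Ring R] {d : ℕ}
    {M : Type u} [AddCommGroup M] [Module R M] (h : HasFiniteProjectiveResolution R d M) :
    ∃ P : ProjectiveResolution (ModuleCat.of R M), (∀ i, Module.Finite R (P.complex.X i)) ∧
      ∀ i, d ≤ i → Limits.IsZero (P.complex.X i) := by
  induction d generalizing M with
  | zero =>
    have : Subsingleton M := h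
    have M_isZero : Limits.IsZero (ModuleCat.of R M) := ModuleCat.isZero_of_subsingleton _
    have : Projective (ModuleCat.of R M) := M_isZero.projective
    have X_isZero : ∀ i,
        Limits.IsZero ((ProjectiveResolution.self (ModuleCat.of R M)).complex.X i)
      | 0 => M_isZero
      | i + 1 => HomologicalComplex.isZero_single_obj_X _ _ _ _ (by simp)
    refine ⟨ProjectiveResolution.self _, fun i => ?_, fun i _ => X_isZero i⟩
    have := ModuleCat.subsingleton_of_isZero (X_isZero i)
    infer_instance
  | succ d ih =>
    obtain ⟨P, _, _, f, hP, hfin, hf, hker⟩ := h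
    obtain ⟨Q, Q_finite, Q_isZero⟩ := ih hker
    exact ⟨spliceProjectiveResolution (S := f.shortComplexKer)
        (LinearMap.shortExact_shortComplexKer hf) ((IsProjective.iff_projective P).1 hP) Q,
      fun
        | 0 => hfin
        | i + 1 => Q_finite i,
      fun
        | 0, hi => absurd hi (Nat.not_succ_le_zero d)
        | i + 1, hi => Q_isZero i (Nat.le_of_succ_le_succ hi)⟩

theorem isHomologicallySmooth_of_hasFiniteProjectiveResolution {k : Type v} [CommRing k]
    {A : Type u} [Ring A] [Algebra k A] {d : ℕ}
    (h : HasFiniteProjectiveResolution (EnvelopingAlgebra k A) d (RegularBimodule k A)) :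
    IsHomologicallySmooth k A := by
  obtain ⟨P, P_finite, P_isZero⟩ := h.exists_projectiveResolution
  exact ⟨P, P_finite, d, fun i hi => P_isZero i hi.le⟩

end FiniteProjectiveResolutions

section CyclicExt

open CategoryTheory Abelian

universe w u' v'

variable {C : Type u'} [Category.{v'} C] [Abelian C] [HasExt.{w} C] {R : Type*} [Ring R]
  {X Y : C} (ρ : R →+* End Y) {i d : ℕ}

/-- The action of `R` on `Ext^i(X, Y)` induced by an action of `R` on `Y`. -/
noncomputable def extAction : R →+* AddMonoid.End (Ext.{w} X Y i) where
  toFun r := (Ext.mk₀ (ρ r)).postcomp X (add_zero i)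
  map_one' := by
    ext α
    rw [map_one]
    exact α.comp_mk₀_id
  map_mul' r s := by
    ext α
    rw [map_mul]
    exact (congrArg (α.comp · (add_zero i)) (Ext.mk₀_comp_mk₀ (ρ s) (ρ r)).symm).trans
      (Ext.comp_assoc_of_third_deg_zero α _ _ (add_zero i)).symm
  map_zero' := by
    ext α
    rw [map_zero, Ext.mk₀_zero]
    exact Ext.comp_zero α _ 0 i (add_zero i)
  map_add' r s := by
    ext α
    rw [map_add, Ext.mk₀_add]
    exact Ext.comp_add α _ _ (add_zero i)

theorem extAction_apply (r : R) (α : Ext.{w} X Y i) :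
    extAction ρ r α = α.comp (Ext.mk₀ (ρ r)) (add_zero i) := rfl

theorem extAction_mul_apply (r s : R) (α : Ext.{w} X Y i) :
    extAction ρ (r * s) α = extAction ρ r (extAction ρ s α) := by
  rw [map_mul]
  rfl

theorem extAction_add_apply (r s : R) (α : Ext.{w} X Y i) :
    extAction ρ (r + s) α = extAction ρ r α + extAction ρ s α := by
  rw [map_add]
  rfl

theorem extAction_sub_apply (r s : R) (α : Ext.{w} X Y i) :
    extAction ρ (r - s) α = extAction ρ r α - extAction ρ s α := by
  rw [map_sub]
  rfl

theorem comp_extAction {X' : C} {j l : ℕ} (β : Ext.{w} X' X j) (r : R) (α : Ext.{w} X Y i)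
    (h : j + i = l) : β.comp (extAction ρ r α) h = extAction ρ r (β.comp α h) :=
  (Ext.comp_assoc_of_third_deg_zero β α _ h).symm

theorem extClass_comp_naturality {S S' : ShortComplex C} (hS : S.ShortExact)
    (hS' : S'.ShortExact) (φ : S ⟶ S') {θ : Ext.{w} S.X₁ Y d} {θ' : Ext.{w} S'.X₁ Y d} {r : R}
    (h : (Ext.mk₀ φ.τ₁).comp θ' (zero_add d) = extAction ρ r θ) :
    (Ext.mk₀ φ.τ₃).comp (hS'.extClass.comp θ' (add_comm 1 d)) (zero_add (d + 1)) =
      extAction ρ r (hS.extClass.comp θ (add_comm 1 d)) := by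
  rw [← Ext.comp_assoc (Ext.mk₀ φ.τ₃) hS'.extClass θ' (zero_add 1) _ (by lia),
    ← ShortComplex.ShortExact.extClass_naturality hS hS' φ,
    Ext.comp_assoc_of_second_deg_zero, h, comp_extAction]

/-- `Ext^i(X, Y)` vanishes for `i ≠ d`, and for `i = d` it is the cyclic `R`-module generated by
`θ`, with annihilator `K`. -/
structure HasCyclicExt (d : ℕ) (X : C) (θ : Ext.{w} X Y d) (K : Submodule R R) : Prop where
  eq_zero : ∀ (i : ℕ), i ≠ d → ∀ α : Ext.{w} X Y i, α = 0
  exists_eq : ∀ α : Ext.{w} X Y d, ∃ r, extAction ρ r θ = α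
  extAction_eq_zero_iff : ∀ r, extAction ρ r θ = 0 ↔ r ∈ K

variable {ρ}

namespace HasCyclicExt

theorem of_projective [Projective Y] (hρ : Function.Bijective ρ) :
    HasCyclicExt.{w} ρ 0 Y (Ext.mk₀ (𝟙 Y)) ⊥ where
  eq_zero i hi α := by
    obtain ⟨i, rfl⟩ := Nat.exists_eq_succ_of_ne_zero hi
    exact Ext.eq_zero_of_projective α
  exists_eq α := by
    obtain ⟨f, rfl⟩ := (Ext.mk₀_bijective _ _).2 α
    obtain ⟨r, rfl⟩ := hρ.2 f
    exact ⟨r, by rw [extAction_apply, Ext.mk₀_id_comp]⟩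
  extAction_eq_zero_iff r := by
    rw [extAction_apply, Ext.mk₀_id_comp, Ext.mk₀_eq_zero_iff, Submodule.mem_bot]
    exact map_eq_zero_iff ρ hρ.1

theorem of_iso {X' : C} (e : X' ≅ X) {θ : Ext.{w} X Y d} {K : Submodule R R}
    (h : HasCyclicExt ρ d X θ K) :
    HasCyclicExt ρ d X' ((Ext.mk₀ e.hom).comp θ (zero_add d)) K := by
  have hom_comp_inv_comp {i : ℕ} (α : Ext.{w} X' Y i) :
      (Ext.mk₀ e.hom).comp ((Ext.mk₀ e.inv).comp α (zero_add i)) (zero_add i) = α := by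
    rw [Ext.mk₀_comp_mk₀_assoc, e.hom_inv_id, Ext.mk₀_id_comp]
  have inv_comp_hom_comp {i : ℕ} (α : Ext.{w} X Y i) :
      (Ext.mk₀ e.inv).comp ((Ext.mk₀ e.hom).comp α (zero_add i)) (zero_add i) = α := by
    rw [Ext.mk₀_comp_mk₀_assoc, e.inv_hom_id, Ext.mk₀_id_comp]
  refine ⟨fun i hi α => ?_, fun α => ?_, fun r => ?_⟩
  · rw [← hom_comp_inv_comp α, h.eq_zero i hi (Ext.comp _ α _), Ext.comp_zero]
  · obtain ⟨r, hr⟩ := h.exists_eq ((Ext.mk₀ e.inv).comp α (zero_add d))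
    exact ⟨r, by rw [← comp_extAction, hr, hom_comp_inv_comp]⟩
  · rw [← comp_extAction, ← h.extAction_eq_zero_iff]
    refine ⟨fun h₀ => ?_, fun h₀ => by rw [h₀, Ext.comp_zero]⟩
    rw [← inv_comp_hom_comp (extAction ρ r θ), h₀, Ext.comp_zero]

section ShortExact

variable {S : ShortComplex C} {θ₁ : Ext.{w} S.X₁ Y d} {θ₂ : Ext.{w} S.X₂ Y d}
  {K₁ K₂ : Submodule R R} (h₁ : HasCyclicExt ρ d S.X₁ θ₁ K₁) (h₂ : HasCyclicExt ρ d S.X₂ θ₂ K₂)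
  {c : R} (f_comp : (Ext.mk₀ S.f).comp θ₂ (zero_add d) = extAction ρ c θ₁)

include f_comp in
theorem mk₀_f_comp_extAction (s : R) :
    (Ext.mk₀ S.f).comp (extAction ρ s θ₂) (zero_add d) = extAction ρ (s * c) θ₁ := by
  rw [comp_extAction, f_comp, extAction_mul_apply]

include h₁ h₂ f_comp

theorem mk₀_g_comp_eq_zero (regular : ∀ s, s * c ∈ K₁ → s ∈ K₂) (α : Ext.{w} S.X₃ Y i) :
    (Ext.mk₀ S.g).comp α (zero_add i) = 0 := by
  obtain rfl | hi := eq_or_ne i d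
  · obtain ⟨s, hs⟩ := h₂.exists_eq ((Ext.mk₀ S.g).comp α (zero_add i))
    have f_comp_zero : (Ext.mk₀ S.f).comp ((Ext.mk₀ S.g).comp α (zero_add i)) (zero_add i) = 0 := by
      rw [Ext.mk₀_comp_mk₀_assoc, S.zero, Ext.mk₀_zero, Ext.zero_comp]
    rw [← hs, mk₀_f_comp_extAction f_comp, h₁.extAction_eq_zero_iff] at f_comp_zero
    rw [← hs, h₂.extAction_eq_zero_iff]
    exact regular s f_comp_zero
  · exact h₂.eq_zero i hi _

/-- If `c` acts injectively from `Ext^d(X₂, Y)` to `Ext^d(X₁, Y)`, the long exact sequence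
identifies `Ext^(d+1)(X₃, Y)` with the cokernel. -/
theorem of_shortExact (hS : S.ShortExact) (regular : ∀ s, s * c ∈ K₁ → s ∈ K₂) :
    HasCyclicExt ρ (d + 1) S.X₃ (hS.extClass.comp θ₁ (add_comm 1 d))
      (K₁ ⊔ Submodule.span R {c}) := by
  have g_comp_eq_zero {i : ℕ} (α : Ext.{w} S.X₃ Y i) :
    (Ext.mk₀ S.g).comp α (zero_add i) = 0 := mk₀_g_comp_eq_zero h₁ h₂ f_comp regular α
  refine ⟨fun i hi α => ?_, fun α => ?_, fun r => ?_⟩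
  · cases i with
    | zero =>
      have := hS.epi_g
      exact Ext.precomp_mk₀_injective_of_epi _ S.g
        ((g_comp_eq_zero α).trans (g_comp_eq_zero 0).symm)
    | succ i =>
      obtain ⟨β, rfl⟩ := Ext.contravariant_sequence_exact₃ hS _ α (g_comp_eq_zero α) (add_comm 1 i)
      rw [h₁.eq_zero i (fun h => hi (congrArg (· + 1) h)) β, Ext.comp_zero]
  · obtain ⟨β, rfl⟩ := Ext.contravariant_sequence_exact₃ hS _ α (g_comp_eq_zero α) (add_comm 1 d)
    obtain ⟨r, rfl⟩ := h₁.exists_eq β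
    exact ⟨r, (comp_extAction _ _ _ _ _).symm⟩
  · rw [← comp_extAction, Submodule.mem_sup]
    constructor
    · intro h
      obtain ⟨β, hβ⟩ := Ext.contravariant_sequence_exact₁ hS _ _ _ h
      obtain ⟨s, rfl⟩ := h₂.exists_eq β
      refine ⟨r - s * c, ?_, s * c, Submodule.mem_span_singleton.2 ⟨s, rfl⟩, sub_add_cancel _ _⟩
      rw [← h₁.extAction_eq_zero_iff, extAction_sub_apply, ← mk₀_f_comp_extAction f_comp, hβ,
        sub_self]
    · rintro ⟨r, hr, _, hsc, rfl⟩
      obtain ⟨s, rfl⟩ := Submodule.mem_span_singleton.1 hsc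
      rw [extAction_add_apply, (h₁.extAction_eq_zero_iff r).2 hr, zero_add,
        smul_eq_mul, ← mk₀_f_comp_extAction f_comp, hS.extClass_comp_assoc]

end ShortExact

end HasCyclicExt

end CyclicExt

section CyclicBimoduleExt

open MulOpposite CategoryTheory Abelian

variable {k : Type v} [CommRing k] {A : Type u} [Ring A] [Algebra k A]

namespace EnvelopingAlgebra

/-- The inner action of `A ⊗ Aᵒᵖ` on itself. -/
noncomputable def innerActionHom : EnvelopingAlgebra k A →+*
    End (ModuleCat.of (EnvelopingAlgebra k A) (EnvelopingAlgebra k A)) where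
  toFun := innerAction
  map_one' := innerAction_one
  map_mul' := innerAction_mul
  map_zero' := innerAction_zero
  map_add' := innerAction_add

theorem innerActionHom_bijective :
    Function.Bijective (innerActionHom : EnvelopingAlgebra k A →+* _) := by
  constructor
  · intro r s h
    have h_one := LinearMap.congr_fun (congrArg ModuleCat.Hom.hom h) 1
    change 1 * (flipOp k A r).unop = 1 * (flipOp k A s).unop at h_one
    rw [one_mul, one_mul] at h_one
    exact (flipOp k A).injective (unop_injective h_one)
  · intro f
    refine ⟨(flipOp k A).symm (op (f.hom 1)), ModuleCat.hom_ext (LinearMap.ext_ring ?_)⟩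
    change 1 * (flipOp k A ((flipOp k A).symm (op (f.hom 1)))).unop = f.hom 1
    rw [AlgEquiv.apply_symm_apply, unop_op, one_mul]

end EnvelopingAlgebra

theorem isTwistedCalabiYau_of_hasCyclicExt {ν : A ≃ₐ[k] A} {d : ℕ}
    {θ : Ext.{u} (ModuleCat.of (EnvelopingAlgebra k A) (RegularBimodule k A))
      (ModuleCat.of (EnvelopingAlgebra k A) (EnvelopingAlgebra k A)) d}
    {K : Submodule (EnvelopingAlgebra k A) (EnvelopingAlgebra k A)}
    (smooth : IsHomologicallySmooth k A)
    (h : HasCyclicExt EnvelopingAlgebra.innerActionHom d _ θ K)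
    (e : (EnvelopingAlgebra k A ⧸ K) ≃ₗ[EnvelopingAlgebra k A] TwistedBimodule k ν) :
    IsTwistedCalabiYau k ν d := by
  let Θ : BimoduleExt k A d := θ
  let π := LinearMap.toSpanSingleton (EnvelopingAlgebra k A) (BimoduleExt k A d) Θ
  have ker_π : LinearMap.ker π = K := Submodule.ext h.extAction_eq_zero_iff
  exact ⟨smooth, fun i hi => ⟨fun α β => (h.eq_zero i hi α).trans (h.eq_zero i hi β).symm⟩,
    ⟨(π.quotKerEquivOfSurjective h.exists_eq).symm.trans
      ((Submodule.quotEquivOfEq _ _ ker_π).trans e)⟩⟩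

end CyclicBimoduleExt

section LeftIdealQuotients

open CategoryTheory

variable {R : Type u} [Ring R] {K K' K₁ K₁' : Submodule R R} {w w₁ : R}

/-- Right multiplication by `w`, as a map between quotients of `R` by left ideals. -/
def quotMulRight (w : R) (h : ∀ r ∈ K', r * w ∈ K) : (R ⧸ K') →ₗ[R] R ⧸ K :=
  Submodule.mapQ K' K (LinearMap.toSpanSingleton R R w) h

theorem quotMulRight_mk (h : ∀ r ∈ K', r * w ∈ K) (r : R) :
    quotMulRight w h (Submodule.Quotient.mk r) = Submodule.Quotient.mk (r * w) := rfl

theorem quotMulRight_injective (h : ∀ r ∈ K', r * w ∈ K) (regular : ∀ r, r * w ∈ K → r ∈ K') :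
    Function.Injective (quotMulRight w h) := by
  refine (injective_iff_map_eq_zero _).2 fun m hm => ?_
  obtain ⟨r, rfl⟩ := Submodule.Quotient.mk_surjective _ m
  rw [quotMulRight_mk, Submodule.Quotient.mk_eq_zero] at hm
  exact (Submodule.Quotient.mk_eq_zero _).2 (regular r hm)

theorem exact_quotMulRight_factor (h : ∀ r ∈ K', r * w ∈ K) :
    Function.Exact (quotMulRight w h)
      (Submodule.factor (le_sup_left : K ≤ K ⊔ Submodule.span R {w})) := by
  intro m
  obtain ⟨r, rfl⟩ := Submodule.Quotient.mk_surjective _ m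
  change (Submodule.Quotient.mk r : R ⧸ K ⊔ Submodule.span R {w}) = 0 ↔ _
  rw [Submodule.Quotient.mk_eq_zero, Submodule.mem_sup]
  constructor
  · rintro ⟨z, hz, _, hsw, rfl⟩
    obtain ⟨s, rfl⟩ := Submodule.mem_span_singleton.1 hsw
    refine ⟨Submodule.Quotient.mk s, ?_⟩
    rw [quotMulRight_mk, Submodule.Quotient.mk_add, (Submodule.Quotient.mk_eq_zero K).2 hz,
      zero_add, smul_eq_mul]
  · rintro ⟨m, hm⟩
    obtain ⟨s, rfl⟩ := Submodule.Quotient.mk_surjective _ m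
    exact ⟨r - s * w, (Submodule.Quotient.eq K).1 hm.symm, s * w,
      Submodule.mem_span_singleton.2 ⟨s, rfl⟩, sub_add_cancel _ _⟩

theorem mul_mem_sup_span_singleton {v v₁ : R} (hv : ∀ r ∈ K, r * v ∈ K₁)
    (comm : w * v = v₁ * w₁) :
    ∀ r ∈ K ⊔ Submodule.span R {w}, r * v ∈ K₁ ⊔ Submodule.span R {w₁} := by
  intro r hr
  obtain ⟨z, hz, _, hsw, rfl⟩ := Submodule.mem_sup.1 hr
  obtain ⟨s, rfl⟩ := Submodule.mem_span_singleton.1 hsw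
  rw [add_mul, smul_mul_assoc, comm]
  exact add_mem (Submodule.mem_sup_left (hv z hz)) (Submodule.mem_sup_right
    (Submodule.smul_mem _ s (Submodule.smul_mem _ v₁ (Submodule.mem_span_singleton_self w₁))))

/-- The sequence `R ⧸ K' → R ⧸ K → R ⧸ (K + R w)` whose first map is right multiplication by
`w`. -/
noncomputable def quotMulRightSequence (w : R) (h : ∀ r ∈ K', r * w ∈ K) :
    ShortComplex (ModuleCat.{u} R) where
  X₁ := ModuleCat.of R (R ⧸ K')
  X₂ := ModuleCat.of R (R ⧸ K)
  X₃ := ModuleCat.of R (R ⧸ K ⊔ Submodule.span R {w})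
  f := ModuleCat.ofHom (quotMulRight w h)
  g := ModuleCat.ofHom (Submodule.factor le_sup_left)
  zero := ModuleCat.hom_ext (exact_quotMulRight_factor h).linearMap_comp_eq_zero

theorem quotMulRightSequence_shortExact (h : ∀ r ∈ K', r * w ∈ K)
    (regular : ∀ r, r * w ∈ K → r ∈ K') : (quotMulRightSequence w h).ShortExact :=
  ModuleCat.shortComplex_shortExact _ (exact_quotMulRight_factor h)
    (quotMulRight_injective h regular) (Submodule.factor_surjective le_sup_left)

/-- Right multiplications by `v₁`, `v` and `v` form a morphism of the sequences
`quotMulRightSequence`. -/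
noncomputable def quotMulRightSequenceMap (h : ∀ r ∈ K', r * w ∈ K) (h₁ : ∀ r ∈ K₁', r * w₁ ∈ K₁)
    {v v₁ : R} (hv₁ : ∀ r ∈ K', r * v₁ ∈ K₁') (hv : ∀ r ∈ K, r * v ∈ K₁)
    (comm : w * v = v₁ * w₁) : quotMulRightSequence w h ⟶ quotMulRightSequence w₁ h₁ where
  τ₁ := ModuleCat.ofHom (quotMulRight v₁ hv₁)
  τ₂ := ModuleCat.ofHom (quotMulRight v hv)
  τ₃ := ModuleCat.ofHom (quotMulRight v (mul_mem_sup_span_singleton hv comm))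
  comm₁₂ := by
    refine ModuleCat.hom_ext (LinearMap.ext fun m => ?_)
    obtain ⟨r, rfl⟩ := Submodule.Quotient.mk_surjective _ m
    change Submodule.Quotient.mk (r * v₁ * w₁) = Submodule.Quotient.mk (r * w * v)
    rw [mul_assoc, mul_assoc, comm]
  comm₂₃ := by
    refine ModuleCat.hom_ext (LinearMap.ext fun m => ?_)
    obtain ⟨r, rfl⟩ := Submodule.Quotient.mk_surjective _ m
    rfl

end LeftIdealQuotients

section QuantumAffineSpaceStructure

/-- A matrix `q` is multiplicatively antisymmetric if `q i i = 1` and `q i j * q j i = 1`: these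
are the parameters for which the monomials form a basis of the quantum affine space. -/
structure IsMulAntisymm {k : Type*} [CommMonoid k] {ι : Type*} (q : Matrix ι ι k) : Prop where
  diag : ∀ i, q i i = 1
  mul_swap : ∀ i j, q i j * q j i = 1

/-- The entries of a multiplicatively antisymmetric matrix, as units. -/
def IsMulAntisymm.unit {k : Type*} [CommMonoid k] {ι : Type*} {q : Matrix ι ι k}
    (hq : IsMulAntisymm q) (i j : ι) : kˣ :=
  ⟨q i j, q j i, hq.mul_swap i j, hq.mul_swap j i⟩

namespace QuantumAffineSpace

variable {k : Type v} [CommRing k] {n : ℕ} {q : Matrix (Fin n) (Fin n) k}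

theorem x_mul_x (i j : Fin n) : x q j * x q i = q i j • (x q i * x q j) := by
  have h := RingQuot.mkAlgHom_rel k (Rel.comm (q := q) i j)
  rwa [map_mul, map_smul, map_mul] at h

/-- The universal property of the quantum affine space. -/
noncomputable def lift {B : Type*} [Ring B] [Algebra k B] (g : Fin n → B)
    (hg : ∀ i j, g j * g i = q i j • (g i * g j)) : QuantumAffineSpace q →ₐ[k] B :=
  RingQuot.liftAlgHom k ⟨FreeAlgebra.lift k g, by
    rintro _ _ ⟨i, j⟩
    simp only [map_mul, map_smul, FreeAlgebra.lift_ι_apply, hg i j]⟩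

@[simp]
theorem lift_x {B : Type*} [Ring B] [Algebra k B] (g : Fin n → B)
    (hg : ∀ i j, g j * g i = q i j • (g i * g j)) (i : Fin n) : lift g hg (x q i) = g i := by
  simp [lift, x]

theorem adjoin_range_x : Algebra.adjoin k (Set.range (x q)) = ⊤ := by
  have range_x : Set.range (x q) = RingQuot.mkAlgHom k (Rel q) '' Set.range (FreeAlgebra.ι k) := by
    rw [← Set.range_comp]
    rfl
  rw [range_x, ← AlgHom.map_adjoin, FreeAlgebra.adjoin_range_ι, Algebra.map_top,
    AlgHom.range_eq_top]
  exact RingQuot.mkAlgHom_surjective k _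

theorem algHom_ext {B : Type*} [Ring B] [Algebra k B] {f g : QuantumAffineSpace q →ₐ[k] B}
    (h : ∀ i, f (x q i) = g (x q i)) : f = g :=
  AlgHom.ext_of_adjoin_eq_top adjoin_range_x (by rintro _ ⟨i, rfl⟩; exact h i)

/-- The diagonal automorphism `x_i ↦ c_i x_i`. -/
noncomputable def scale (c : Fin n → kˣ) : QuantumAffineSpace q ≃ₐ[k] QuantumAffineSpace q :=
  have relation (c : Fin n → kˣ) (i j : Fin n) : ((c j : k) • x q j) * ((c i : k) • x q i) =
      q i j • (((c i : k) • x q i) * ((c j : k) • x q j)) := by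
    rw [smul_mul_smul_comm, smul_mul_smul_comm, x_mul_x i j, smul_comm, mul_comm (c i : k)]
  AlgEquiv.ofAlgHom (lift (fun i => (c i : k) • x q i) (relation c))
    (lift (fun i => ((c⁻¹) i : k) • x q i) (relation c⁻¹))
    (algHom_ext fun i => by simp [smul_smul])
    (algHom_ext fun i => by simp [smul_smul])

theorem scale_x (c : Fin n → kˣ) (i : Fin n) : scale c (x q i) = (c i : k) • x q i :=
  lift_x _ _ i

theorem scale_symm_x (c : Fin n → kˣ) (i : Fin n) :
    (scale c).symm (x q i) = ((c i)⁻¹ : kˣ).val • x q i :=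
  lift_x _ _ i

theorem induction_mul_right {P : QuantumAffineSpace q → Prop} (one : P 1)
    (add : ∀ a b, P a → P b → P (a + b)) (smul : ∀ (c : k) a, P a → P (c • a))
    (mul_x : ∀ a i, P a → P (a * x q i)) (a : QuantumAffineSpace q) : P a := by
  have ha : a ∈ Submodule.span k (Submonoid.closure (Set.range (x q)) : Set _) := by
    rw [← Algebra.adjoin_eq_span, adjoin_range_x, Algebra.top_toSubmodule]
    exact Submodule.mem_top
  induction ha using Submodule.span_induction with
  | mem a ha =>
    induction ha using Submonoid.closure_induction_right with
    | one => exact one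
    | mul_right a _ _ hi h =>
      obtain ⟨i, rfl⟩ := hi
      exact mul_x a i h
  | zero => simpa using smul 0 1 one
  | add a b _ _ ha hb => exact add a b ha hb
  | smul c a _ ha => exact smul c a ha

section RightDivision

variable (hq : IsMulAntisymm q) (j : Fin n)

/-- The representation of the quantum affine space by `2 × 2` matrices over itself in which the
lower left entry of each matrix is zero, the upper left one is the element represented, and the
upper right one is the quotient of its right division by `x_j`, see `rightDiv`. -/
noncomputable def divMatrix :
    QuantumAffineSpace q →ₐ[k] Matrix (Fin 2) (Fin 2) (QuantumAffineSpace q) :=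
  lift (fun i => if i = j then !![x q j, 1; 0, 0] else !![x q i, 0; 0, q i j • x q i]) (by
    intro i l
    split_ifs with hi hl hl <;> ext a b <;> fin_cases a <;> fin_cases b <;>
      simp [Matrix.mul_apply, Fin.sum_univ_two, smul_smul, mul_comm, mul_left_comm, hq.diag,
        hq.mul_swap, hi, hl, x_mul_x i l, x_mul_x i j, x_mul_x j l])

/-- Right division by `x_j`: the `k`-linear map which divides the monomials ending in `x_j` by
`x_j` and kills the monomials in the other generators. -/
noncomputable def rightDiv : Module.End k (QuantumAffineSpace q) where
  toFun a := divMatrix hq j a 0 1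
  map_add' a b := by simp
  map_smul' c a := by simp

theorem divMatrix_apply_zero_zero (a : QuantumAffineSpace q) : divMatrix hq j a 0 0 = a := by
  induction a using induction_mul_right with
  | one => simp
  | add a b ha hb => simp [ha, hb]
  | smul c a ha => simp [ha]
  | mul_x a i ha =>
    rw [map_mul, Matrix.mul_apply, Fin.sum_univ_two, ha, divMatrix, lift_x]
    split_ifs with h <;> simp [h]

theorem rightDiv_mul (a b : QuantumAffineSpace q) :
    rightDiv hq j (a * b) = a * rightDiv hq j b + rightDiv hq j a * divMatrix hq j b 1 1 := by
  change divMatrix hq j (a * b) 0 1 = _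
  rw [map_mul, Matrix.mul_apply, Fin.sum_univ_two, divMatrix_apply_zero_zero]
  rfl

theorem rightDiv_one : rightDiv hq j 1 = 0 := by
  simp [rightDiv]

theorem rightDiv_mul_x_self (a : QuantumAffineSpace q) : rightDiv hq j (a * x q j) = a := by
  have rightDiv_x : rightDiv hq j (x q j) = 1 := by simp [rightDiv, divMatrix]
  simp [rightDiv_mul, rightDiv_x, divMatrix]

theorem rightDiv_mul_x {i : Fin n} (hi : i ≠ j) (a : QuantumAffineSpace q) :
    rightDiv hq j (a * x q i) = q i j • (rightDiv hq j a * x q i) := by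
  have rightDiv_x : rightDiv hq j (x q i) = 0 := by simp [rightDiv, divMatrix, hi]
  simp [rightDiv_mul, rightDiv_x, divMatrix, hi]

theorem exists_rightDiv_pow_eq_zero (a : QuantumAffineSpace q) :
    ∃ N, (rightDiv hq j ^ N) a = 0 := by
  induction a using induction_mul_right with
  | one => exact ⟨1, by rw [pow_one, rightDiv_one]⟩
  | add a b ha hb =>
    obtain ⟨N, hN⟩ := ha
    obtain ⟨M, hM⟩ := hb
    exact ⟨max N M, by rw [map_add, Module.End.pow_map_zero_of_le (le_max_left N M) hN,
      Module.End.pow_map_zero_of_le (le_max_right N M) hM, add_zero]⟩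
  | smul c a ha =>
    obtain ⟨N, hN⟩ := ha
    exact ⟨N, by rw [map_smul, hN, smul_zero]⟩
  | mul_x a i ha =>
    obtain ⟨N, hN⟩ := ha
    by_cases hi : i = j
    · exact ⟨N + 1, by rw [hi, pow_succ, Module.End.mul_apply, rightDiv_mul_x_self, hN]⟩
    have pow_mul_x (M : ℕ) : (rightDiv hq j ^ M) (a * x q i) =
        q i j ^ M • ((rightDiv hq j ^ M) a * x q i) := by
      induction M with
      | zero => simp
      | succ M ih =>
        rw [pow_succ', Module.End.mul_apply, ih, map_smul, rightDiv_mul_x hq j hi, smul_smul,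
          ← pow_succ, Module.End.mul_apply]
    exact ⟨N, by rw [pow_mul_x, hN, zero_mul, smul_zero]⟩

end RightDivision

end QuantumAffineSpace

end QuantumAffineSpaceStructure

section Units

namespace QuantumAffineSpace

open Polynomial

variable {k : Type v} [CommRing k] {n : ℕ} {q : Matrix (Fin n) (Fin n) k}

variable (q) in
/-- The product of the generators along a list of indices. -/
noncomputable def word (l : List (Fin n)) : QuantumAffineSpace q := (l.map (x q)).prod

theorem word_nil : word q [] = 1 := rfl

theorem word_append (l l' : List (Fin n)) : word q (l ++ l') = word q l * word q l' := by
  simp [word]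

theorem word_singleton (i : Fin n) : word q [i] = x q i := by
  simp [word]

theorem exists_word_eq_smul_of_perm {l l' : List (Fin n)} (h : l.Perm l') :
    ∃ c : k, word q l = c • word q l' := by
  have word_cons (i : Fin n) (l : List (Fin n)) : word q (i :: l) = x q i * word q l := by
    simp [word]
  induction h with
  | nil => exact ⟨1, (one_smul _ _).symm⟩
  | cons i _ ih =>
    obtain ⟨c, hc⟩ := ih
    exact ⟨c, by rw [word_cons, word_cons, hc, mul_smul_comm]⟩
  | swap i j l =>
    exact ⟨q i j, by simp only [word_cons, ← mul_assoc, x_mul_x i j, smul_mul_assoc]⟩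
  | trans _ _ ih ih' =>
    obtain ⟨c, hc⟩ := ih
    obtain ⟨c', hc'⟩ := ih'
    exact ⟨c * c', by rw [hc, hc', smul_smul]⟩

theorem span_range_word : Submodule.span k (Set.range (word q)) = ⊤ := by
  rw [eq_top_iff, ← Algebra.top_toSubmodule, ← adjoin_range_x, Algebra.adjoin_eq_span]
  refine Submodule.span_mono fun a ha => ?_
  obtain ⟨l, hl, rfl⟩ := Submonoid.exists_list_of_mem_closure ha
  obtain ⟨l, rfl⟩ : l ∈ Set.range (List.map (x q)) := by rwa [Set.range_list_map]
  exact ⟨l, rfl⟩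

theorem eq_zero_of_smul_word_eq_zero (hq : IsMulAntisymm q) {c : k} {l : List (Fin n)}
    (h : c • word q l = 0) : c = 0 := by
  induction l using List.reverseRecOn with
  | nil =>
    have map_one := congrArg (lift (q := q) (fun _ => (0 : k)) (by simp)) h
    simpa [word_nil] using map_one
  | append_singleton l i ih =>
    refine ih ?_
    rw [← rightDiv_mul_x_self hq i (c • word q l), smul_mul_assoc, ← word_singleton,
      ← word_append, h, map_zero]

/-- The multidegree of a word. -/
noncomputable def wordDegree (l : List (Fin n)) : Fin n →₀ ℕ :=
  Multiset.toFinsupp (l : Multiset (Fin n))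

theorem wordDegree_append (l l' : List (Fin n)) :
    wordDegree (l ++ l') = wordDegree l + wordDegree l' := by
  rw [wordDegree, ← Multiset.coe_add, map_add]
  rfl

theorem perm_of_wordDegree_eq {l l' : List (Fin n)} (h : wordDegree l = wordDegree l') :
    l.Perm l' :=
  Multiset.coe_eq_coe.1 (Multiset.toFinsupp.injective h)

theorem exists_wordDegree_eq (d : Fin n →₀ ℕ) : ∃ l, wordDegree l = d :=
  ⟨(Multiset.toFinsupp.symm d).toList, by
    rw [wordDegree, Multiset.coe_toList, AddEquiv.apply_symm_apply]⟩

variable (q) in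
/-- The decomposition of an element into its multihomogeneous components. -/
noncomputable def decompose :
    QuantumAffineSpace q →ₐ[k] AddMonoidAlgebra (QuantumAffineSpace q) (Fin n →₀ ℕ) :=
  lift (fun i => AddMonoidAlgebra.single (Finsupp.single i 1) (x q i)) fun i j => by
    rw [AddMonoidAlgebra.single_mul_single, AddMonoidAlgebra.single_mul_single, x_mul_x i j,
      AddMonoidAlgebra.smul_single, add_comm]

theorem decompose_injective : Function.Injective (decompose q) := by
  let sumComponents : AddMonoidAlgebra (QuantumAffineSpace q) (Fin n →₀ ℕ) →ₐ[k] _ :=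
    AddMonoidAlgebra.liftNCAlgHom (AlgHom.id k (QuantumAffineSpace q)) 1
      fun _ _ => Commute.one_right _
  have sumComponents_comp : sumComponents.comp (decompose q) = AlgHom.id k _ :=
    algHom_ext fun i => by simp [sumComponents, decompose]
  exact Function.LeftInverse.injective (g := sumComponents) (DFunLike.congr_fun sumComponents_comp)

theorem decompose_word (l : List (Fin n)) :
    decompose q (word q l) = AddMonoidAlgebra.single (wordDegree l) (word q l) := by
  induction l using List.reverseRecOn with
  | nil => simp [word, wordDegree, AddMonoidAlgebra.one_def]
  | append_singleton l i ih =>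
    rw [word_append, map_mul, ih, word_singleton, decompose, lift_x,
      AddMonoidAlgebra.single_mul_single, wordDegree_append]
    simp [wordDegree]

theorem coeff_decompose_mem_span_word (a : QuantumAffineSpace q) (l : List (Fin n)) :
    (decompose q a).coeff (wordDegree l) ∈ Submodule.span k {word q l} := by
  induction (span_range_word (q := q).symm ▸ Submodule.mem_top :
      a ∈ Submodule.span k (Set.range (word q))) using Submodule.span_induction with
  | mem a ha =>
    obtain ⟨l', rfl⟩ := ha
    rw [decompose_word, AddMonoidAlgebra.coeff_single]
    by_cases h : wordDegree l' = wordDegree l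
    · obtain ⟨c, hc⟩ := exists_word_eq_smul_of_perm (q := q) (perm_of_wordDegree_eq h)
      rw [h, Finsupp.single_eq_same, hc]
      exact Submodule.smul_mem _ c (Submodule.mem_span_singleton_self _)
    · rw [Finsupp.single_apply, if_neg h]
      exact zero_mem _
  | zero => simp
  | add a b _ _ ha hb =>
    rw [map_add, AddMonoidAlgebra.coeff_add, Finsupp.add_apply]
    exact add_mem ha hb
  | smul c a _ ha =>
    rw [map_smul, AddMonoidAlgebra.coeff_smul, Finsupp.smul_apply]
    exact Submodule.smul_mem _ c ha

theorem noZeroDivisors [NoZeroDivisors k] (hq : IsMulAntisymm q) :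
    NoZeroDivisors (QuantumAffineSpace q) where
  eq_zero_or_eq_zero_of_mul_eq_zero {a b} hab := by
    by_contra! h
    have support_nonempty {a : QuantumAffineSpace q} (ha : a ≠ 0) :
        (decompose q a).coeff.support.Nonempty := by
      simpa using (map_ne_zero_iff _ decompose_injective).2 ha
    obtain ⟨d, hd, e, he, unique⟩ :=
      UniqueSums.uniqueAdd_of_nonempty (support_nonempty h.1) (support_nonempty h.2)
    obtain ⟨l, rfl⟩ := exists_wordDegree_eq d
    obtain ⟨l', rfl⟩ := exists_wordDegree_eq e
    obtain ⟨c, hc⟩ := Submodule.mem_span_singleton.1 (coeff_decompose_mem_span_word a l)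
    obtain ⟨c', hc'⟩ := Submodule.mem_span_singleton.1 (coeff_decompose_mem_span_word b l')
    have product_eq_zero : (c * c') • word q (l ++ l') = 0 := by
      rw [word_append, ← smul_mul_smul_comm, hc, hc',
        ← AddMonoidAlgebra.coeff_mul_add_of_uniqueAdd unique, ← map_mul, hab]
      simp
    rw [Finsupp.mem_support_iff] at hd he
    rcases mul_eq_zero.1 (eq_zero_of_smul_word_eq_zero hq product_eq_zero) with rfl | rfl
    · exact hd (by rw [← hc, zero_smul])
    · exact he (by rw [← hc', zero_smul])

variable (q) in
/-- The homomorphism `a ↦ ∑ a_d X^d`, where `a_d` is the component of `a` of total degree `d`. -/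
noncomputable def toPolynomial : QuantumAffineSpace q →ₐ[k] (QuantumAffineSpace q)[X] :=
  lift (fun i => monomial 1 (x q i)) fun i j => by
    rw [monomial_mul_monomial, monomial_mul_monomial, x_mul_x i j, smul_monomial]

theorem exists_algebraMap_eq_of_isUnit [NoZeroDivisors k] (hq : IsMulAntisymm q)
    {u : QuantumAffineSpace q} (hu : IsUnit u) : ∃ c : k, algebraMap k _ c = u := by
  have := noZeroDivisors hq
  obtain ⟨r, -, hr⟩ := isUnit_iff.1 (hu.map (toPolynomial q))
  let eval (t : k) : (QuantumAffineSpace q)[X] →ₐ[k] QuantumAffineSpace q :=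
    eval₂AlgHom (AlgHom.id k _) (algebraMap k _ t) fun a => (Algebra.commutes t a).symm
  have eval_C (t : k) (a : QuantumAffineSpace q) : eval t (C a) = a := eval₂_C _ _
  have eval_toPolynomial_x (t : k) (i : Fin n) : eval t (toPolynomial q (x q i)) = t • x q i := by
    rw [toPolynomial, lift_x, Algebra.smul_def, Algebra.commutes]
    exact (eval₂_monomial _ _).trans (by rw [pow_one]; rfl)
  have eval_one : (eval 1).comp (toPolynomial q) = AlgHom.id k _ :=
    algHom_ext fun i => by simp [eval_toPolynomial_x]
  have eval_zero : (eval 0).comp (toPolynomial q) =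
      (Algebra.ofId k _).comp (lift (fun _ => 0) (by simp)) :=
    algHom_ext fun i => by simp [eval_toPolynomial_x]
  have hu_one : r = u := by
    simpa [← hr, eval_C] using DFunLike.congr_fun eval_one u
  have hu_zero : r = algebraMap k _ (lift (fun _ => 0) (by simp) u) := by
    simpa [← hr, eval_C] using DFunLike.congr_fun eval_zero u
  exact ⟨_, hu_zero.symm.trans hu_one⟩

theorem units_commute [NoZeroDivisors k] (hq : IsMulAntisymm q) (u : (QuantumAffineSpace q)ˣ)
    (a : QuantumAffineSpace q) : Commute (u : QuantumAffineSpace q) a := by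
  obtain ⟨c, hc⟩ := exists_algebraMap_eq_of_isUnit hq u.isUnit
  exact hc ▸ Algebra.commutes c a

end QuantumAffineSpace

end Units

section LinearIdeals

open MulOpposite

namespace QuantumAffineSpace

variable {k : Type v} [CommRing k] {n : ℕ} (q : Matrix (Fin n) (Fin n) k)

/-- The element `x_i ⊗ 1` of the enveloping algebra. -/
noncomputable def xl (i : Fin n) : EnvelopingAlgebra k (QuantumAffineSpace q) := x q i ⊗ₜ 1

/-- The element `1 ⊗ x_i` of the enveloping algebra. -/
noncomputable def xr (i : Fin n) : EnvelopingAlgebra k (QuantumAffineSpace q) := 1 ⊗ₜ op (x q i)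

theorem xl_mul_xl (i j : Fin n) : xl q j * xl q i = q i j • (xl q i * xl q j) := by
  simp only [xl, Algebra.TensorProduct.tmul_mul_tmul, x_mul_x i j, TensorProduct.smul_tmul']

theorem xr_mul_xr (i j : Fin n) : xr q i * xr q j = q i j • (xr q j * xr q i) := by
  simp only [xr, Algebra.TensorProduct.tmul_mul_tmul, ← op_mul, x_mul_x i j, op_smul,
    TensorProduct.tmul_smul]

theorem xr_mul_xl (i j : Fin n) : xr q i * xl q j = xl q j * xr q i := by
  simp only [xl, xr, Algebra.TensorProduct.tmul_mul_tmul, one_mul, mul_one]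

/-- The linear form `s (x_j ⊗ 1) - t (1 ⊗ x_j)` of the enveloping algebra. -/
noncomputable def linearForm (s t : k) (j : Fin n) : EnvelopingAlgebra k (QuantumAffineSpace q) :=
  s • xl q j - t • xr q j

/-- The left ideal generated by the linear forms `x_i ⊗ 1 - κ_i (1 ⊗ x_i)` with `i ∈ S`. -/
noncomputable def linearIdeal (S : Finset (Fin n)) (κ : Fin n → kˣ) :
    Submodule (EnvelopingAlgebra k (QuantumAffineSpace q))
      (EnvelopingAlgebra k (QuantumAffineSpace q)) :=
  Submodule.span _ ((fun i => linearForm q 1 (κ i) i) '' S)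

theorem linearIdeal_empty (κ : Fin n → kˣ) : linearIdeal q ∅ κ = ⊥ := by
  rw [linearIdeal, Finset.coe_empty, Set.image_empty, Submodule.span_empty]

theorem linearIdeal_insert (S : Finset (Fin n)) (κ : Fin n → kˣ) (j : Fin n) :
    linearIdeal q (insert j S) κ =
      linearIdeal q S κ ⊔ Submodule.span _ {linearForm q 1 (κ j) j} := by
  rw [linearIdeal, Finset.coe_insert, Set.image_insert_eq, Submodule.span_insert, sup_comm]
  rfl

variable {q}

theorem linearForm_mem_linearIdeal {S : Finset (Fin n)} (κ : Fin n → kˣ) {i : Fin n} (hi : i ∈ S) :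
    linearForm q 1 (κ i) i ∈ linearIdeal q S κ :=
  Submodule.subset_span ⟨i, Finset.mem_coe.2 hi, rfl⟩

theorem linearForm_mul_linearForm (hq : IsMulAntisymm q) (i j : Fin n) (s t c : k) :
    linearForm q 1 (q j i * c) i * linearForm q s t j =
      linearForm q (s * q j i) t j * linearForm q 1 c i := by
  simp only [linearForm, sub_mul, mul_sub, smul_mul_smul_comm, xr_mul_xl, xl_mul_xl q j i,
    xr_mul_xr q i j, smul_smul, one_mul, mul_one]
  rw [show q j i * c * s = s * q j i * c by ring,
    show q j i * c * t * q i j = t * c by linear_combination t * c * hq.mul_swap j i]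
  exact sub_sub_sub_comm _ _ _ _

variable (hq : IsMulAntisymm q)

theorem mul_linearForm_mem_linearIdeal {S : Finset (Fin n)} {κ : Fin n → kˣ} {j : Fin n} (s t : k)
    {r : EnvelopingAlgebra k (QuantumAffineSpace q)}
    (hr : r ∈ linearIdeal q S (hq.unit j * κ)) : r * linearForm q s t j ∈ linearIdeal q S κ := by
  induction hr using Submodule.span_induction with
  | mem y hy =>
    obtain ⟨i, hi, rfl⟩ := hy
    exact (linearForm_mul_linearForm hq i j s t (κ i)).symm ▸
      Submodule.smul_mem _ _ (linearForm_mem_linearIdeal κ (Finset.mem_coe.1 hi))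
  | zero => rw [zero_mul]; exact zero_mem _
  | add y z _ _ hy hz => rw [add_mul]; exact add_mem hy hz
  | smul a y _ hy => rw [smul_eq_mul, mul_assoc]; exact Submodule.smul_mem _ _ hy

section Division

variable (j : Fin n)

/-- Right division by `x_j ⊗ 1` in the enveloping algebra. -/
noncomputable def envRightDiv : Module.End k (EnvelopingAlgebra k (QuantumAffineSpace q)) :=
  LinearMap.rTensor _ (rightDiv hq j)

theorem envRightDiv_tmul (a : QuantumAffineSpace q) (b : (QuantumAffineSpace q)ᵐᵒᵖ) :
    envRightDiv hq j (a ⊗ₜ b) = rightDiv hq j a ⊗ₜ b := rfl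

theorem envRightDiv_mul_xl_self (r : EnvelopingAlgebra k (QuantumAffineSpace q)) :
    envRightDiv hq j (r * xl q j) = r := by
  induction r using TensorProduct.induction_on with
  | zero => rw [zero_mul, map_zero]
  | tmul a b =>
    rw [xl, Algebra.TensorProduct.tmul_mul_tmul, envRightDiv_tmul, rightDiv_mul_x_self, mul_one]
  | add r s hr hs => rw [add_mul, map_add, hr, hs]

theorem envRightDiv_mul_xl {i : Fin n} (hi : i ≠ j)
    (r : EnvelopingAlgebra k (QuantumAffineSpace q)) :
    envRightDiv hq j (r * xl q i) = q i j • (envRightDiv hq j r * xl q i) := by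
  induction r using TensorProduct.induction_on with
  | zero => rw [zero_mul, map_zero, zero_mul, smul_zero]
  | tmul a b =>
    rw [xl, Algebra.TensorProduct.tmul_mul_tmul, envRightDiv_tmul, rightDiv_mul_x hq j hi,
      envRightDiv_tmul, Algebra.TensorProduct.tmul_mul_tmul, TensorProduct.smul_tmul']
  | add r s hr hs => rw [add_mul, map_add, hr, hs, map_add, add_mul, smul_add]

theorem envRightDiv_mul_xr (i : Fin n) (r : EnvelopingAlgebra k (QuantumAffineSpace q)) :
    envRightDiv hq j (r * xr q i) = envRightDiv hq j r * xr q i := by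
  induction r using TensorProduct.induction_on with
  | zero => rw [zero_mul, map_zero, zero_mul]
  | tmul a b =>
    rw [xr, Algebra.TensorProduct.tmul_mul_tmul, envRightDiv_tmul, envRightDiv_tmul,
      Algebra.TensorProduct.tmul_mul_tmul, mul_one, mul_one]
  | add r s hr hs => rw [add_mul, map_add, hr, hs, map_add, add_mul]

theorem exists_envRightDiv_pow_eq_zero (r : EnvelopingAlgebra k (QuantumAffineSpace q)) :
    ∃ N, (envRightDiv hq j ^ N) r = 0 := by
  induction r using TensorProduct.induction_on with
  | zero => exact ⟨0, map_zero _⟩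
  | tmul a b =>
    obtain ⟨N, hN⟩ := exists_rightDiv_pow_eq_zero hq j a
    refine ⟨N, (LinearMap.congr_fun (LinearMap.rTensor_pow _ N) (a ⊗ₜ b)).trans ?_⟩
    rw [LinearMap.rTensor_tmul, hN, TensorProduct.zero_tmul]
  | add r s hr hs =>
    obtain ⟨N, hN⟩ := hr
    obtain ⟨M, hM⟩ := hs
    exact ⟨max N M, by rw [map_add, Module.End.pow_map_zero_of_le (le_max_left N M) hN,
      Module.End.pow_map_zero_of_le (le_max_right N M) hM, add_zero]⟩

theorem envRightDiv_mul_linearForm {i : Fin n} (hi : i ≠ j) (c : k)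
    (r : EnvelopingAlgebra k (QuantumAffineSpace q)) :
    envRightDiv hq j (r * linearForm q 1 c i) =
      (q i j • envRightDiv hq j r) * linearForm q 1 (q j i * c) i := by
  rw [linearForm, linearForm, mul_sub, map_sub, one_smul, envRightDiv_mul_xl hq j hi,
    mul_smul_comm, map_smul, envRightDiv_mul_xr, mul_sub, smul_mul_assoc, smul_mul_smul_comm,
    ← mul_assoc, hq.mul_swap, one_mul]

theorem envRightDiv_mul_linearForm_self (s t : k)
    (r : EnvelopingAlgebra k (QuantumAffineSpace q)) :
    envRightDiv hq j (r * linearForm q s t j) = s • r - t • (envRightDiv hq j r * xr q j) := by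
  rw [linearForm, mul_sub, map_sub, mul_smul_comm, mul_smul_comm, map_smul, map_smul,
    envRightDiv_mul_xl_self, envRightDiv_mul_xr]

variable {j}

theorem envRightDiv_mem_linearIdeal {S : Finset (Fin n)} (hj : j ∉ S) {κ : Fin n → kˣ}
    {r : EnvelopingAlgebra k (QuantumAffineSpace q)} (hr : r ∈ linearIdeal q S κ) :
    envRightDiv hq j r ∈ linearIdeal q S (hq.unit j * κ) := by
  suffices ∀ a, envRightDiv hq j (a * r) ∈ linearIdeal q S (hq.unit j * κ) by
    simpa only [one_mul] using this 1
  induction hr using Submodule.span_induction with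
  | mem y hy =>
    intro a
    obtain ⟨i, hi, rfl⟩ := hy
    have hij : i ≠ j := fun h => hj (h ▸ Finset.mem_coe.1 hi)
    exact (envRightDiv_mul_linearForm hq j hij (κ i) a).symm ▸
      Submodule.smul_mem _ _ (linearForm_mem_linearIdeal (hq.unit j * κ) (Finset.mem_coe.1 hi))
  | zero => intro a; rw [mul_zero, map_zero]; exact zero_mem _
  | add y z _ _ hy hz => intro a; rw [mul_add, map_add]; exact add_mem (hy a) (hz a)
  | smul b y _ hy => intro a; rw [smul_eq_mul, ← mul_assoc]; exact hy _

theorem mem_linearIdeal_of_smul_sub_mem {S : Finset (Fin n)} (hj : j ∉ S) (s : kˣ) (t : k)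
    {N : ℕ} {κ : Fin n → kˣ} {r : EnvelopingAlgebra k (QuantumAffineSpace q)}
    (hN : (envRightDiv hq j ^ N) r = 0)
    (hr : (s : k) • r - t • (envRightDiv hq j r * xr q j) ∈ linearIdeal q S κ) :
    r ∈ linearIdeal q S κ := by
  induction N generalizing κ r with
  | zero => exact (show r = 0 from hN) ▸ zero_mem _
  | succ N ih =>
    have quotient_mem : envRightDiv hq j r ∈ linearIdeal q S (hq.unit j * κ) := by
      have h := envRightDiv_mem_linearIdeal hq hj hr
      rw [map_sub, map_smul, map_smul, envRightDiv_mul_xr] at h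
      exact ih (by rwa [← Module.End.mul_apply, ← pow_succ]) h
    have smul_mem : (s : k) • r ∈ linearIdeal q S κ := by
      have h := mul_linearForm_mem_linearIdeal hq 0 t quotient_mem
      rw [linearForm, mul_sub, zero_smul, mul_zero, mul_smul_comm] at h
      simpa only [sub_sub_sub_cancel_right, sub_zero] using sub_mem hr h
    rw [← inv_smul_smul s r]
    exact Submodule.smul_of_tower_mem _ (s⁻¹ : kˣ).val smul_mem

theorem mem_linearIdeal_of_mul_linearForm_mem {S : Finset (Fin n)} (hj : j ∉ S) (s : kˣ) (t : k)
    {κ : Fin n → kˣ} {r : EnvelopingAlgebra k (QuantumAffineSpace q)}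
    (hr : r * linearForm q s t j ∈ linearIdeal q S κ) : r ∈ linearIdeal q S (hq.unit j * κ) := by
  obtain ⟨N, hN⟩ := exists_envRightDiv_pow_eq_zero hq j r
  refine mem_linearIdeal_of_smul_sub_mem hq hj s t hN ?_
  exact envRightDiv_mul_linearForm_self hq j s t r ▸ envRightDiv_mem_linearIdeal hq hj hr

end Division

theorem relatorIdeal_range_x {ν : QuantumAffineSpace q ≃ₐ[k] QuantumAffineSpace q}
    {κ : Fin n → kˣ} (hν : ∀ i, ν.symm (x q i) = (κ i : k) • x q i) :
    TwistedBimodule.relatorIdeal ν (Set.range (x q)) = linearIdeal q Finset.univ κ := by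
  rw [TwistedBimodule.relatorIdeal, linearIdeal, Finset.coe_univ, Set.image_univ, ← Set.range_comp]
  simp only [Function.comp_def, hν, linearForm, one_smul, op_smul, TensorProduct.tmul_smul]
  rfl

end QuantumAffineSpace

end LinearIdeals

section KoszulExt

open MulOpposite CategoryTheory Abelian EnvelopingAlgebra

namespace QuantumAffineSpace

variable {k : Type u} [CommRing k] {n : ℕ} {q : Matrix (Fin n) (Fin n) k} (hq : IsMulAntisymm q)

include hq in
theorem hasFiniteProjectiveResolution_quot_linearIdeal (S : Finset (Fin n)) (κ : Fin n → kˣ) :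
    HasFiniteProjectiveResolution (EnvelopingAlgebra k (QuantumAffineSpace q)) (S.card + 1)
      (EnvelopingAlgebra k (QuantumAffineSpace q) ⧸ linearIdeal q S κ) := by
  induction S using Finset.induction_on generalizing κ with
  | empty =>
    exact (HasFiniteProjectiveResolution.of_projective _).of_equiv
      (Submodule.quotEquivOfEqBot _ (linearIdeal_empty q κ)).symm
  | insert j S hj ih =>
    rw [Finset.card_insert_of_notMem hj, linearIdeal_insert]
    have mul_mem : ∀ r ∈ linearIdeal q S (hq.unit j * κ), r * linearForm q 1 (κ j) j ∈
        linearIdeal q S κ := fun r => mul_linearForm_mem_linearIdeal hq 1 (κ j)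
    exact .of_cokernel
      (quotMulRight_injective mul_mem fun r => mem_linearIdeal_of_mul_linearForm_mem hq hj 1 (κ j))
      (Submodule.factor_surjective le_sup_left) (exact_quotMulRight_factor mul_mem)
      (ih _) (ih κ).succ

/-- The sequence `R ⧸ (unit j * κ, S) → R ⧸ (κ, S) → R ⧸ (κ, insert j S)` given by right
multiplication by `x_j ⊗ 1 - κ_j (1 ⊗ x_j)`, where `R` is the enveloping algebra and `(κ, S)` is
the left ideal `linearIdeal q S κ`. -/
noncomputable def koszulSequence (S : Finset (Fin n)) (j : Fin n) (κ : Fin n → kˣ) :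
    ShortComplex (ModuleCat.{u} (EnvelopingAlgebra k (QuantumAffineSpace q))) :=
  quotMulRightSequence (K := linearIdeal q S κ) (linearForm q 1 (κ j) j)
    fun _ => mul_linearForm_mem_linearIdeal hq 1 (κ j)

theorem koszulSequence_shortExact {S : Finset (Fin n)} {j : Fin n} (hj : j ∉ S)
    (κ : Fin n → kˣ) : (koszulSequence hq S j κ).ShortExact :=
  quotMulRightSequence_shortExact _ fun _ => mem_linearIdeal_of_mul_linearForm_mem hq hj 1 (κ j)

theorem unop_flipOp_smul_xr_sub_smul_xl (s t : k) (j : Fin n) :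
    (flipOp k _ (s • xr q j - t • xl q j)).unop = linearForm q s t j := by
  rw [map_sub, map_smul, map_smul]
  rfl

/-- The parameters for which `linearIdeal q S (dualParam hq S κ)` annihilates the generator of
`Ext` of the quotient by `linearIdeal q S κ`. -/
def dualParam (S : Finset (Fin n)) (κ : Fin n → kˣ) : Fin n → kˣ :=
  fun i => (∏ l ∈ S, hq.unit i l) / κ i

theorem dualParam_insert {S : Finset (Fin n)} {j : Fin n} (hj : j ∉ S) (κ : Fin n → kˣ) :
    dualParam hq (insert j S) κ = dualParam hq S (hq.unit j * κ) := by
  funext i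
  have unit_swap : hq.unit i j * hq.unit j i = 1 := Units.ext (hq.mul_swap i j)
  rw [dualParam, dualParam, Finset.prod_insert hj, Pi.mul_apply,
    eq_inv_of_mul_eq_one_left unit_swap, mul_div_assoc, inv_mul_eq_div, div_div, mul_comm]

theorem unit_mul_dualParam (S : Finset (Fin n)) (j : Fin n) (κ : Fin n → kˣ) :
    hq.unit j * dualParam hq S (hq.unit j * κ) = dualParam hq S κ := by
  funext i
  rw [Pi.mul_apply, dualParam, dualParam, Pi.mul_apply, mul_div_assoc', mul_div_mul_left_eq_div]

theorem smul_xr_sub_smul_xl_eq_smul_linearForm (S : Finset (Fin n)) (j : Fin n)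
    (κ : Fin n → kˣ) :
    (∏ l ∈ S, q j l) • xr q j - (κ j : k) • xl q j =
      (-κ j) • linearForm q 1 (dualParam hq S (hq.unit j * κ) j) j := by
  have mul_dualParam : (κ j : k) * dualParam hq S (hq.unit j * κ) j = ∏ l ∈ S, q j l := by
    have unit_self : hq.unit j j = 1 := Units.ext (hq.diag j)
    rw [← Units.val_mul, dualParam, Pi.mul_apply, unit_self, one_mul, mul_div_cancel,
      Units.coe_prod]
    rfl
  rw [linearForm, smul_sub, one_smul, Units.smul_def, Units.smul_def, Units.val_neg, smul_smul,
    neg_mul, mul_dualParam, neg_smul, neg_smul]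
  abel

theorem linearIdeal_dualParam_insert {S : Finset (Fin n)} {j : Fin n} (hj : j ∉ S)
    (κ : Fin n → kˣ) :
    linearIdeal q (insert j S) (dualParam hq (insert j S) κ) =
      linearIdeal q S (dualParam hq S (hq.unit j * κ)) ⊔
        Submodule.span _ {(∏ l ∈ S, q j l) • xr q j - (κ j : k) • xl q j} := by
  rw [smul_xr_sub_smul_xl_eq_smul_linearForm hq, Submodule.span_singleton_group_smul_eq,
    dualParam_insert hq hj, linearIdeal_insert]

theorem mem_linearIdeal_dualParam_of_mul_mem {S : Finset (Fin n)} {j : Fin n} (hj : j ∉ S)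
    (κ : Fin n → kˣ) {r : EnvelopingAlgebra k (QuantumAffineSpace q)}
    (hr : r * ((∏ l ∈ S, q j l) • xr q j - (κ j : k) • xl q j) ∈
      linearIdeal q S (dualParam hq S (hq.unit j * κ))) :
    r ∈ linearIdeal q S (dualParam hq S κ) := by
  rw [smul_xr_sub_smul_xl_eq_smul_linearForm hq, mul_smul_comm] at hr
  rw [← unit_mul_dualParam hq S j κ]
  refine mem_linearIdeal_of_mul_linearForm_mem hq hj 1 (dualParam hq S (hq.unit j * κ) j) ?_
  have h := Submodule.smul_of_tower_mem _ (-κ j)⁻¹ hr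
  rwa [inv_smul_smul] at h

/-- The classes `θ κ` generate the `Ext` groups of the quotients by the left ideals `I κ`,
compatibly with right multiplications by linear forms. Here `I` is `linearIdeal q S`, up to
equality. -/
structure IsKoszulFamily (S : Finset (Fin n)) (I : (Fin n → kˣ) → Submodule
      (EnvelopingAlgebra k (QuantumAffineSpace q)) (EnvelopingAlgebra k (QuantumAffineSpace q)))
    (d : ℕ) (θ : ∀ κ, Ext.{u}
      (ModuleCat.of (EnvelopingAlgebra k (QuantumAffineSpace q))
        (EnvelopingAlgebra k (QuantumAffineSpace q) ⧸ I κ))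
      (ModuleCat.of (EnvelopingAlgebra k (QuantumAffineSpace q))
        (EnvelopingAlgebra k (QuantumAffineSpace q))) d) : Prop where
  hasCyclicExt : ∀ κ, HasCyclicExt innerActionHom d _ (θ κ) (I (dualParam hq S κ))
  naturality : ∀ (κ κ' : Fin n → kˣ) (j : Fin n), j ∉ S → κ' = hq.unit j * κ →
    ∀ (s t : k) (h : ∀ r ∈ I κ', r * linearForm q s t j ∈ I κ),
      (Ext.mk₀ (ModuleCat.ofHom (quotMulRight _ h))).comp (θ κ) (zero_add d) =
        extAction innerActionHom ((s * ∏ l ∈ S, q j l) • xr q j - t • xl q j) (θ κ')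

theorem exists_isKoszulFamily_empty : ∃ θ, IsKoszulFamily hq ∅ (linearIdeal q ∅) 0 θ := by
  let e κ := (Submodule.quotEquivOfEqBot _ (linearIdeal_empty q κ)).toModuleIso
  refine ⟨fun κ => (Ext.mk₀ (e κ).hom).comp (Ext.mk₀ (𝟙 _)) (zero_add 0), fun κ => ?_, ?_⟩
  · rw [linearIdeal_empty q (dualParam hq ∅ κ)]
    exact .of_iso (e κ) (.of_projective innerActionHom_bijective)
  · intro κ κ' j _ _ s t h
    rw [Ext.comp_mk₀_id, Ext.comp_mk₀_id, extAction_apply, Ext.mk₀_comp_mk₀, Ext.mk₀_comp_mk₀]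
    refine congrArg _ (ModuleCat.hom_ext (LinearMap.ext fun m => ?_))
    obtain ⟨r, rfl⟩ := Submodule.Quotient.mk_surjective _ m
    change r * linearForm q s t j = r * (flipOp k _ _).unop
    rw [unop_flipOp_smul_xr_sub_smul_xl, Finset.prod_empty, mul_one]

variable {hq}

theorem IsKoszulFamily.hasCyclicExt_koszulSequence {S : Finset (Fin n)} {d : ℕ} {j : Fin n}
    (hj : j ∉ S) {θ} (hθ : IsKoszulFamily hq S (linearIdeal q S) d θ) (κ : Fin n → kˣ) :
    HasCyclicExt innerActionHom (d + 1) (koszulSequence hq S j κ).X₃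
      ((koszulSequence_shortExact hq hj κ).extClass.comp (θ (hq.unit j * κ)) (add_comm 1 d))
      (linearIdeal q (insert j S) (dualParam hq (insert j S) κ)) := by
  rw [linearIdeal_dualParam_insert hq hj κ]
  have f_comp := hθ.naturality κ _ j hj rfl 1 (κ j)
    fun r => mul_linearForm_mem_linearIdeal hq 1 (κ j)
  rw [one_mul] at f_comp
  exact HasCyclicExt.of_shortExact (S := koszulSequence hq S j κ)
    (hθ.hasCyclicExt (hq.unit j * κ)) (hθ.hasCyclicExt κ) f_comp (koszulSequence_shortExact hq hj κ)
    fun r => mem_linearIdeal_dualParam_of_mul_mem hq hj κ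

theorem IsKoszulFamily.exists_insert {S : Finset (Fin n)} {d : ℕ} {j : Fin n} (hj : j ∉ S) {θ}
    (hθ : IsKoszulFamily hq S (linearIdeal q S) d θ) :
    ∃ θ', IsKoszulFamily hq (insert j S) (linearIdeal q (insert j S)) (d + 1) θ' := by
  have insert_eq : linearIdeal q (insert j S) = _ := funext fun κ => linearIdeal_insert q S κ j
  have hasCyclicExt := hθ.hasCyclicExt_koszulSequence hj
  rw [insert_eq] at hasCyclicExt ⊢
  refine ⟨fun κ => (koszulSequence_shortExact hq hj κ).extClass.comp (θ (hq.unit j * κ))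
    (add_comm 1 d), hasCyclicExt, ?_⟩
  intro κ κ' l hl hκ s t _
  have swap : hq.unit j * κ' = hq.unit l * (hq.unit j * κ) := by rw [hκ, mul_left_comm]
  have mul_mem r (hr : r ∈ linearIdeal q S (hq.unit j * κ')) :
      r * linearForm q (s * q l j) t l ∈ linearIdeal q S (hq.unit j * κ) :=
    mul_linearForm_mem_linearIdeal hq _ t (swap ▸ hr)
  have comm : linearForm q 1 (κ' j) j * linearForm q s t l =
      linearForm q (s * q l j) t l * linearForm q 1 (κ j) j :=
    hκ ▸ linearForm_mul_linearForm hq j l s t (κ j)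
  let φ : koszulSequence hq S j κ' ⟶ koszulSequence hq S j κ :=
    quotMulRightSequenceMap _ _ mul_mem
      (fun r hr => mul_linearForm_mem_linearIdeal hq s t (hκ ▸ hr)) comm
  have naturality : (Ext.mk₀ φ.τ₁).comp (θ (hq.unit j * κ)) (zero_add d) =
      extAction innerActionHom ((s * ∏ l' ∈ insert j S, q l l') • xr q l - t • xl q l)
        (θ (hq.unit j * κ')) := by
    rw [Finset.prod_insert hj, ← mul_assoc]
    exact hθ.naturality _ _ l (fun hlS => hl (Finset.mem_insert_of_mem hlS)) swap _ t mul_mem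
  exact extClass_comp_naturality (θ := θ (hq.unit j * κ')) (θ' := θ (hq.unit j * κ))
    innerActionHom (koszulSequence_shortExact hq hj κ') (koszulSequence_shortExact hq hj κ)
    φ naturality

theorem exists_isKoszulFamily (hq : IsMulAntisymm q) (S : Finset (Fin n)) :
    ∃ θ, IsKoszulFamily hq S (linearIdeal q S) S.card θ := by
  induction S using Finset.induction_on with
  | empty => exact exists_isKoszulFamily_empty hq
  | insert j S hj ih =>
    obtain ⟨θ, hθ⟩ := ih
    rw [Finset.card_insert_of_notMem hj]
    exact hθ.exists_insert hj

end QuantumAffineSpace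

end KoszulExt

section NakayamaAutomorphism

namespace QuantumAffineSpace

variable {k : Type u} [CommRing k] {n : ℕ} {q : Matrix (Fin n) (Fin n) k}

/-- If `ν` rescales the generators, then the bimodule `A^ν` is generated by `1`, and the
annihilator of `1` is the left ideal generated by the linear forms. -/
noncomputable def quotLinearIdealEquiv {ν : QuantumAffineSpace q ≃ₐ[k] QuantumAffineSpace q}
    {κ : Fin n → kˣ} (hν : ∀ i, ν.symm (x q i) = (κ i : k) • x q i) :
    (EnvelopingAlgebra k (QuantumAffineSpace q) ⧸ linearIdeal q Finset.univ κ)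
      ≃ₗ[EnvelopingAlgebra k (QuantumAffineSpace q)] TwistedBimodule k ν :=
  (Submodule.quotEquivOfEq _ _ (relatorIdeal_range_x hν).symm).trans
    (TwistedBimodule.quotRelatorIdealEquiv ν adjoin_range_x)

variable (q) in
/-- The regular bimodule as a quotient of the enveloping algebra. -/
noncomputable def quotLinearIdealOneEquiv :
    (EnvelopingAlgebra k (QuantumAffineSpace q) ⧸ linearIdeal q Finset.univ 1)
      ≃ₗ[EnvelopingAlgebra k (QuantumAffineSpace q)] RegularBimodule k (QuantumAffineSpace q) :=
  quotLinearIdealEquiv (ν := AlgEquiv.refl) fun i => (one_smul k (x q i)).symm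

variable (hq : IsMulAntisymm q)

include hq in
theorem isHomologicallySmooth : IsHomologicallySmooth k (QuantumAffineSpace q) :=
  isHomologicallySmooth_of_hasFiniteProjectiveResolution
    ((hasFiniteProjectiveResolution_quot_linearIdeal hq Finset.univ 1).of_equiv
      (quotLinearIdealOneEquiv q))

/-- The Nakayama automorphism `x_i ↦ (∏_j q_{ji}) x_i`. -/
noncomputable def nakayamaAut : QuantumAffineSpace q ≃ₐ[k] QuantumAffineSpace q :=
  scale fun i => ∏ j, hq.unit j i

theorem nakayamaAut_x (i : Fin n) : nakayamaAut hq (x q i) = (∏ j, q j i) • x q i := by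
  rw [nakayamaAut, scale_x, Units.coe_prod]
  rfl

theorem nakayamaAut_symm_x (i : Fin n) :
    (nakayamaAut hq).symm (x q i) = (dualParam hq Finset.univ 1 i : k) • x q i := by
  have dualParam_eq : dualParam hq Finset.univ 1 i = (∏ j, hq.unit j i)⁻¹ := by
    rw [dualParam, Pi.one_apply, div_one, ← Finset.prod_inv_distrib]
    rfl
  rw [nakayamaAut, scale_symm_x, dualParam_eq]

theorem isTwistedCalabiYau : IsTwistedCalabiYau k (nakayamaAut hq) n := by
  have exists_family := exists_isKoszulFamily hq Finset.univ
  rw [Finset.card_univ, Fintype.card_fin] at exists_family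
  obtain ⟨θ, hθ⟩ := exists_family
  exact isTwistedCalabiYau_of_hasCyclicExt (isHomologicallySmooth hq)
    (.of_iso (quotLinearIdealOneEquiv q).symm.toModuleIso (hθ.hasCyclicExt 1))
    (quotLinearIdealEquiv (nakayamaAut_symm_x hq))

include hq in
theorem eq_of_isTwistedCalabiYau [NoZeroDivisors k] {d : ℕ}
    {ν ν' : QuantumAffineSpace q ≃ₐ[k] QuantumAffineSpace q}
    (hν : IsTwistedCalabiYau k ν d) (hν' : IsTwistedCalabiYau k ν' d) : ν = ν' := by
  obtain ⟨e⟩ := hν.ext_iso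
  obtain ⟨e'⟩ := hν'.ext_iso
  exact TwistedBimodule.eq_of_linearEquiv (units_commute hq) (e.symm.trans e')

end QuantumAffineSpace

end NakayamaAutomorphism

theorem mainTheorem5_general {k : Type u} [CommRing k] [NoZeroDivisors k] {n : ℕ}
    (q : Matrix (Fin n) (Fin n) k) (hq_diag : ∀ i, q i i = 1)
    (hq_inv : ∀ i j, q i j * q j i = 1) :
    ∃ ν : QuantumAffineSpace q ≃ₐ[k] QuantumAffineSpace q,
      IsTwistedCalabiYau k ν n ∧
      (∀ i, ν (QuantumAffineSpace.x q i) = (∏ j, q j i) • QuantumAffineSpace.x q i) ∧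
      ∀ ν' : QuantumAffineSpace q ≃ₐ[k] QuantumAffineSpace q,
        IsTwistedCalabiYau k ν' n → ν' = ν := by
  have hq : IsMulAntisymm q := ⟨hq_diag, hq_inv⟩
  have calabiYau := QuantumAffineSpace.isTwistedCalabiYau hq
  exact ⟨QuantumAffineSpace.nakayamaAut hq, calabiYau, QuantumAffineSpace.nakayamaAut_x hq,
    fun ν' hν' => QuantumAffineSpace.eq_of_isTwistedCalabiYau hq hν' calabiYau⟩


theorem mainTheorem5 {k : Type u} [Field k] {n : ℕ} (hn : 1 ≤ n)
    (q : Matrix (Fin n) (Fin n) k) (hq_diag : ∀ i, q i i = 1)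
    (hq_inv : ∀ i j, q i j * q j i = 1) :
    ∃ ν : QuantumAffineSpace q ≃ₐ[k] QuantumAffineSpace q,
      IsTwistedCalabiYau k ν n ∧
      (∀ i, ν (QuantumAffineSpace.x q i) = (∏ j, q j i) • QuantumAffineSpace.x q i) ∧
      ∀ ν' : QuantumAffineSpace q ≃ₐ[k] QuantumAffineSpace q,
        IsTwistedCalabiYau k ν' n → ν' = ν :=
  mainTheorem5_general q hq_diag hq_inv
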